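/- **Setting.** For every $c>c_0>0$ let $(\mathcal M_c,g_c)$ be a smooth four-dimensional Lorentzian manifold (signature $-+++$, speed of light $c$, cosmological constant $\lambda_c$) with a smooth timelike Killing field $\vec K_c$ on an open set, let $\sigma_c$ be an integral curve of $\vec K_c$ parametrized by proper time (so $g_c(\vec K_c,\vec K_c)=-c^2$ along $\sigma_c$), and let $e_0=\sigma_c'(0),e_1,e_2,e_3$ be an orthonormal tetrad at $\sigma_c(0)$ (with $e_1,e_2,e_3$ unit vectors). The Fermi surface is $\{p: g_c(\exp_{\sigma_c(0)}^{-1}p,\sigma_c'(0))=0\}$, with $\exp^{-1}$ defined on the image of a star-shaped open domain on which $\exp_{\sigma_c(0)}$ is a diffeomorphism. It is assumed to be spacelike and to lie in the region where $\vec K_c$ is timelike. It is identified, through its Fermi coordinates $x=(x^1,x^2,x^3)\mapsto\exp_{\sigma_c(0)}(\sum_i x^ie_i)$, with an open set $X\subset\mathbb R^3$, which is assumed not to depend on $c$; $d\mathbf x$ is Lebesgue measure on $X$. Write $\|\vec K_c\|=\sqrt{-g_c(\vec K_c,\vec K_c)}$ and assume that $\alpha(1/c,x)=\|\vec K_c\|(x)/c$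 extends to a smooth function $\alpha(y,x)$ on $[0,1/c_0)\times X$ with $\alpha(0,x)=1$ and $\partial_y\alpha(0,x)=0$ for all $x\in X$. **Configurations.** $\Gamma_X$ is the set of locally finite subsets of $X$, $\mathcal B_c(X)$ the set of Borel sets with compact closure in $X$, $N_\Lambda(x)=|x\cap\Lambda|$, $\mathcal B_\Lambda=\sigma\{N_{\Lambda'}:\Lambda'\subset\Lambda,\ \Lambda'\in\mathcal B_c(X)\}$, and $\mathcal B(\Gamma_X)=\sigma\{N_\Lambda:\Lambda\in\mathcal B_c(X)\}$. A cylinder set is a member of $\mathcal B_\Lambda$ for some $\Lambda\in\mathcal B_c(X)$. **Gibbs states.** Given $\beta>0$, an activity $z>0$, potentials $\phi_n$ ($n\ge1$) and an energy $\phi_0(\Lambda)\in\mathbb R$ of the empty configuration, put $\nu_\Lambda=\sum_{n\ge0}\frac{z^n}{n!}d\mathbf x^n$ on the finite configurations in $\Lambda$, $$V_\Lambda(x|s)=\phi_0(\Lambda)+\sum_{n\ge1}\ \sum_{\substack{y\subset x\cup(s\setminus\Lambda)\\ y\cap x\ne\varnothing,\ |y|=n}}\phi_n(y)$$ (and $+\infty$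 if the sum does not converge absolutely), $Z_\Lambda(s)=\int e^{-\beta V_\Lambda(x|s)}\nu_\Lambda(dx)$, and $$\Pi_\Lambda(A,s)=\frac{1_{\{Z_\Lambda(s)<\infty\}}}{Z_\Lambda(s)}\int 1_A(x\cup(s\setminus\Lambda))\,e^{-\beta V_\Lambda(x|s)}\,\nu_\Lambda(dx).$$ A Gibbs state is a probability measure $\mu$ on $(\Gamma_X,\mathcal B(\Gamma_X))$ with $\int\Pi_\Lambda(A,s)\,\mu(ds)=\mu(A)$ for all $A\in\mathcal B(\Gamma_X)$ and $\Lambda\in\mathcal B_c(X)$. **Ideal gases.** Fix $m,\beta,\hbar,G>0$ and a chemical potential $\mu_{\rm ch}\in\mathbb R$. The *relativistic ideal gas* has $\phi_n=0$ for $n\ge2$, $e^{-\beta\phi_1}=K_2(\gamma)/\gamma$ with $\gamma=\|\vec K_c\|\beta mc$ and $K_2$ the modified Bessel function of the second kind, $z=\frac{4\pi(mc)^3}{(2\pi\hbar)^3}e^{\beta(mc^2+\mu_{\rm ch})}$, and $\phi_0(\Lambda)=|\Lambda|\,\lambda_cc^4/(8\pi G)$, where $|\Lambda|$ is the volume of $\Lambda$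 for the metric induced by $g_c$ on the Fermi surface. The *Newtonian ideal gas* has $\phi_n=0$ for $n\ge2$, $\phi_1(x)=\frac12m\,\partial_y^2\alpha(0,x)$, $z_{\rm Newt}=\left(\frac{m}{2\pi\hbar^2\beta}\right)^{3/2}e^{\beta\mu_{\rm ch}}$ and $\phi_0=0$. **Statement.** Suppose that $X$ is unbounded. Then for every $c>c_0$ the relativistic ideal gas has exactly one Gibbs state $\mu_c$, the Newtonian ideal gas has exactly one Gibbs state $\mu_{\rm Newt}$, and for every cylinder set $A$ $$\lim_{c\to\infty}\mu_c(A)=\mu_{\rm Newt}(A).$$ -/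

import Mathlib

open Set Filter Topology MeasureTheory
open scoped Manifold ContDiff ENNReal

universe u

noncomputable section

/-! ### Configurations of point particles -/

/-- Locally finite subsets of `X`: the configuration space `Γ_X`. -/
structure Configuration (X : Type*) [TopologicalSpace X] where
  carrier : Set X
  finite_inter_compact : ∀ K : Set X, IsCompact K → (carrier ∩ K).Finite

/-- `𝓑_c(X)`: the measurable (Borel) sets with compact closure. -/
def BoundedBorel (X : Type*) [TopologicalSpace X] [MeasurableSpace X] : Set (Set X) :=
  {S | MeasurableSet S ∧ IsCompact (closure S)}

namespace Configuration

variable {X : Type*} [TopologicalSpace X]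

/-- `N_S(x) = |x ∩ S|` (finite when `S` has compact closure). -/
def count (S : Set X) (x : Configuration X) : ℕ := (x.carrier ∩ S).ncard

/-- The σ-algebra `𝓑_S = σ{N_T : T ⊆ S, T ∈ 𝓑_c(X)}` of events observable in `S`. -/
abbrev localSigma [MeasurableSpace X] (S : Set X) : MeasurableSpace (Configuration X) :=
  ⨆ T ∈ {T : Set X | T ∈ BoundedBorel X ∧ T ⊆ S}, MeasurableSpace.comap (count T) ⊤

/-- `𝓑(Γ_X)`, generated by all `N_T` with `T ∈ 𝓑_c(X)`. -/
instance [MeasurableSpace X] : MeasurableSpace (Configuration X) := localSigma univ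

/-- A cylinder set: a member of `𝓑_S` for some `S ∈ 𝓑_c(X)`. -/
def IsCylinder [MeasurableSpace X] (A : Set (Configuration X)) : Prop :=
  ∃ S ∈ BoundedBorel X, MeasurableSet[localSigma S] A

/-- The part `x_{X \ S}` of a configuration outside `S`. -/
def outside (S : Set X) (x : Configuration X) : Configuration X where
  carrier := x.carrier ∩ Sᶜ
  finite_inter_compact K hK := (x.finite_inter_compact K hK).subset (by
    rintro p ⟨⟨h1, _⟩, h2⟩
    exact ⟨h1, h2⟩)

/-- The union of two configurations. -/
def union (x y : Configuration X) : Configuration X where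
  carrier := x.carrier ∪ y.carrier
  finite_inter_compact K hK := by
    rw [union_inter_distrib_right]
    exact (x.finite_inter_compact K hK).union (y.finite_inter_compact K hK)

/-- The map `(x₁, …, xₙ) ↦ {x₁, …, xₙ}`. -/
def ofTuple {n : ℕ} (v : Fin n → X) : Configuration X where
  carrier := range v
  finite_inter_compact _ _ := (finite_range v).inter_of_left _

end Configuration

/-! ### The grand canonical ensemble -/

/-- The data of a grand canonical ensemble on a one-particle configuration space `X`:
the one-particle volume `dx`, the inverse temperature, the activity, the energy
`φ₀ = V_S(∅)` of the empty configuration in each region `S`, and the `n`-body potentials,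
`φₙ(y)` being `potential y` for `|y| = n ≥ 1`. -/
structure GrandCanonical (X : Type*) [TopologicalSpace X] [MeasurableSpace X] where
  dx : Measure X
  beta : ℝ
  activity : ℝ
  vacuumEnergy : Set X → ℝ
  potential : Finset X → WithTop ℝ

namespace GrandCanonical

variable {X : Type*} [TopologicalSpace X] [MeasurableSpace X] (E : GrandCanonical X)

/-- `n`-tuples of pairwise distinct points of `S`. -/
def distinctTuples (S : Set X) (n : ℕ) : Set (Fin n → X) :=
  {v | (∀ i, v i ∈ S) ∧ Function.Injective v}

/-- The unnormalized Poisson measure `ν_S = ∑ₙ (zⁿ / n!) dxⁿ`, as a measure on `Γ_X` carried by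
the finite configurations contained in `S`. -/
def poisson (S : Set X) : Measure (Configuration X) :=
  Measure.sum fun n : ℕ => ENNReal.ofReal (E.activity ^ n / n.factorial) •
    ((Measure.pi fun _ : Fin n => E.dx).restrict (distinctTuples S n)).map Configuration.ofTuple

/-- The finite clusters `y ⊆ x ∪ (s ∩ X \ S)` that meet `x`. -/
def clusters (S : Set X) (x s : Configuration X) : Set (Finset X) :=
  {y | (y : Set X) ⊆ x.carrier ∪ (s.carrier ∩ Sᶜ) ∧ ((y : Set X) ∩ x.carrier).Nonempty}

open Classical in
/-- The energy `V_S(x | s)` of `x` in `S` with boundary condition `s`: the vacuum energy plus the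
sum of `φ_{|y|}(y)` over all clusters if this sum converges absolutely, and `+∞` otherwise. -/
def energy (S : Set X) (x s : Configuration X) : WithTop ℝ :=
  if (∀ y ∈ clusters S x s, E.potential y ≠ ⊤) ∧
      Summable (fun y : clusters S x s => (E.potential y).untopD 0) then
    ((E.vacuumEnergy S + ∑' y : clusters S x s, (E.potential y).untopD 0 : ℝ) : WithTop ℝ)
  else ⊤

/-- `exp (-β V)`, with `exp (-∞) = 0`. -/
def boltzmann (β : ℝ) : WithTop ℝ → ℝ≥0∞
  | none => 0
  | some v => ENNReal.ofReal (Real.exp (-β * v))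

/-- The partition function `Z_S(s)`. -/
def partitionFunction (S : Set X) (s : Configuration X) : ℝ≥0∞ :=
  ∫⁻ x, boltzmann E.beta (E.energy S x s) ∂(E.poisson S)

open Classical in
/-- The specification `Π_S(A, s)`. -/
def specification (S : Set X) (A : Set (Configuration X)) (s : Configuration X) : ℝ≥0∞ :=
  if E.partitionFunction S s < ⊤ then
    (E.partitionFunction S s)⁻¹ *
      ∫⁻ x, A.indicator 1 (x.union (s.outside S)) * boltzmann E.beta (E.energy S x s) ∂(E.poisson S)
  else 0

/-- Gibbs states: the probability measures on `Γ_X` satisfying the DLR equations. -/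
def IsGibbsState (μ : Measure (Configuration X)) : Prop :=
  IsProbabilityMeasure μ ∧
    ∀ S ∈ BoundedBorel X, ∀ A : Set (Configuration X), MeasurableSet A →
      ∫⁻ s, E.specification S A s ∂μ = μ A

/-- The ideal gas potentials: `φ₁` is the given one-body potential and `φₙ = 0` for `n ≥ 2`. -/
def idealPotential (φ₁ : X → ℝ) (y : Finset X) : WithTop ℝ :=
  if y.card = 1 then ((∑ p ∈ y, φ₁ p : ℝ) : WithTop ℝ) else 0

end GrandCanonical

/-! ### Lorentzian geometry -/

/-- Coordinates on space-time. -/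
abbrev E4 := EuclideanSpace ℝ (Fin 4)

/-- Coordinates on space. -/
abbrev E3 := EuclideanSpace ℝ (Fin 3)

/-- A smooth metric of signature `(-,+,+,+)` on a four-dimensional manifold. -/
structure LorentzMetric (M : Type*) [TopologicalSpace M] [ChartedSpace E4 M]
    [IsManifold 𝓘(ℝ, E4) ∞ M] where
  form (p : M) : TangentSpace 𝓘(ℝ, E4) p →L[ℝ] TangentSpace 𝓘(ℝ, E4) p →L[ℝ] ℝ
  symm (p : M) (v w : TangentSpace 𝓘(ℝ, E4) p) : form p v w = form p w v
  lorentzian (p : M) : ∃ b : Module.Basis (Fin 4) ℝ (TangentSpace 𝓘(ℝ, E4) p),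
    ∀ i j, form p (b i) (b j) = if i = j then (if i = 0 then -1 else 1) else 0
  contMDiff : ContMDiff 𝓘(ℝ, E4) (𝓘(ℝ, E4).prod 𝓘(ℝ, E4 →L[ℝ] E4 →L[ℝ] ℝ)) ∞
    (fun p ↦ Bundle.TotalSpace.mk' (E4 →L[ℝ] E4 →L[ℝ] ℝ)
      (E := fun p : M => TangentSpace 𝓘(ℝ, E4) p →L[ℝ] TangentSpace 𝓘(ℝ, E4) p →L[ℝ] ℝ)
      p (form p))

namespace LorentzMetric

variable {M : Type*} [TopologicalSpace M] [ChartedSpace E4 M] [IsManifold 𝓘(ℝ, E4) ∞ M]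
  (g : LorentzMetric M)

/-- The metric in the chart at `p`, at the point with coordinates `u`, applied to `v` and `w`:
`g_{ab}(u) vᵃ wᵇ`. -/
def inChart (p : M) (u v w : E4) : ℝ :=
  g.form ((chartAt E4 p).symm u)
    (mfderiv 𝓘(ℝ, E4) 𝓘(ℝ, E4) (chartAt E4 p).symm u v)
    (mfderiv 𝓘(ℝ, E4) 𝓘(ℝ, E4) (chartAt E4 p).symm u w)

/-- `γ` is an affinely parametrized geodesic at every parameter in `I`: with `u` the curve in the
chart at `γ t`, the equation `g_{ad} u''ᵃ + (∂_b g_{ad} - ½ ∂_d g_{ab}) u'ᵃ u'ᵇ = 0` holds, which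
is the geodesic equation of the Levi-Civita connection with an index lowered. -/
def IsGeodesicOn (γ : ℝ → M) (I : Set ℝ) : Prop :=
  ∀ t ∈ I, ContinuousAt γ t ∧ ContDiffAt ℝ 2 (fun r => chartAt E4 (γ t) (γ r)) t ∧
    ∀ w : E4,
      let u : ℝ → E4 := fun r => chartAt E4 (γ t) (γ r)
      let u' : E4 := deriv u t
      g.inChart (γ t) (u t) (deriv (deriv u) t) w
        + fderiv ℝ (fun q => g.inChart (γ t) q u' w) (u t) u'
        - fderiv ℝ (fun q => g.inChart (γ t) q u' u') (u t) w / 2 = 0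

/-- `γ` is a geodesic, defined on an interval around `[0,1]`, with initial velocity `v` at `p`. -/
def IsGeodesicFrom (p : M) (v : TangentSpace 𝓘(ℝ, E4) p) (γ : ℝ → M) : Prop :=
  (∃ δ > 0, g.IsGeodesicOn γ (Ioo (-δ) (1 + δ))) ∧
    (⟨γ 0, mfderiv 𝓘(ℝ, ℝ) 𝓘(ℝ, E4) γ 0 (1 : ℝ)⟩ : TangentBundle 𝓘(ℝ, E4) M) = ⟨p, v⟩

open Classical in
/-- The exponential map (with the junk value `p` where it is not defined). -/
def expMap (p : M) (v : TangentSpace 𝓘(ℝ, E4) p) : M :=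
  if h : ∃ γ, g.IsGeodesicFrom p v γ then h.choose 1 else p

/-- The map `l ↦ exp_p (∑ lᵃ e_a)` inverse to normal coordinates at `p` with respect to a frame. -/
def normalMap (p : M) (e : Fin 4 → TangentSpace 𝓘(ℝ, E4) p) (l : E4) : M :=
  g.expMap p (∑ a, l a • e a)

/-- `N` is (in components with respect to the frame `e`) an open star-shaped neighbourhood of the
origin of the tangent space at `p` on which the exponential map is defined and is a diffeomorphism
onto an open set: its image is a normal neighbourhood of `p`. -/
structure IsNormalDomain (p : M) (e : Fin 4 → TangentSpace 𝓘(ℝ, E4) p) (N : Set E4) : Prop where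
  isOpen : IsOpen N
  zero_mem : (0 : E4) ∈ N
  starConvex : StarConvex ℝ 0 N
  exp_defined : ∀ l ∈ N, ∃ γ, g.IsGeodesicFrom p (∑ a, l a • e a) γ
  smooth : ContMDiffOn 𝓘(ℝ, E4) 𝓘(ℝ, E4) ∞ (g.normalMap p e) N
  injOn : InjOn (g.normalMap p e) N
  immersive : ∀ l ∈ N, Function.Bijective (mfderiv 𝓘(ℝ, E4) 𝓘(ℝ, E4) (g.normalMap p e) l)

/-- The Killing equation `K^c ∂_c g_{ab} + g_{cb} ∂_a K^c + g_{ac} ∂_b K^c = 0` at the points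
of `U`. -/
def IsKillingOn (K : (p : M) → TangentSpace 𝓘(ℝ, E4) p) (U : Set M) : Prop :=
  ∀ p ∈ U, ∀ v w : E4,
    let k : E4 → E4 := fun u =>
      mfderiv 𝓘(ℝ, E4) 𝓘(ℝ, E4) (chartAt E4 p) ((chartAt E4 p).symm u)
        (K ((chartAt E4 p).symm u))
    let o : E4 := chartAt E4 p p
    fderiv ℝ (fun u => g.inChart p u v w) o (k o)
      + g.inChart p o (fderiv ℝ k o v) w + g.inChart p o v (fderiv ℝ k o w) = 0

end LorentzMetric

/-- A space-time in units with speed of light `c`, with a timelike Killing field `K` on an open set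
`U`, an observer `σ` whose four-velocity is `K`, an orthonormal tetrad at `σ 0` whose
timelike member is the four-velocity, and a normal neighbourhood of `σ 0` determining the Fermi
surface. -/
structure KillingObserver (c : ℝ) where
  M : Type u
  [top : TopologicalSpace M]
  [t2 : T2Space M]
  [charted : ChartedSpace E4 M]
  [manifold : IsManifold 𝓘(ℝ, E4) ∞ M]
  g : LorentzMetric M
  /-- The cosmological constant. -/
  cosmological : ℝ
  U : Set M
  isOpen_U : IsOpen U
  K : (p : M) → TangentSpace 𝓘(ℝ, E4) p
  smooth_K : ContMDiffOn 𝓘(ℝ, E4) 𝓘(ℝ, E4).tangent ∞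
    (fun p => (⟨p, K p⟩ : TangentBundle 𝓘(ℝ, E4) M)) U
  killing : g.IsKillingOn K U
  timelike : ∀ p ∈ U, g.form p (K p) (K p) < 0
  /-- The parameter interval of the observer's path. -/
  J : Set ℝ
  isOpen_J : IsOpen J
  connected_J : J.OrdConnected
  zero_mem_J : (0 : ℝ) ∈ J
  σ : ℝ → M
  σ_mem : ∀ τ ∈ J, σ τ ∈ U
  σ_tangent : IsMIntegralCurveOn σ K J
  /-- `σ` is parametrized by proper time. -/
  σ_proper : ∀ τ ∈ J, g.form (σ τ) (K (σ τ)) (K (σ τ)) = -c ^ 2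
  tetrad : Fin 4 → TangentSpace 𝓘(ℝ, E4) (σ 0)
  tetrad_zero : tetrad 0 = K (σ 0)
  tetrad_orthonormal : ∀ a b, g.form (σ 0) (tetrad a) (tetrad b) =
    if a = b then (if a = 0 then -c ^ 2 else 1) else 0
  /-- The normal neighbourhood, in components with respect to the tetrad. -/
  N : Set E4
  normal_N : g.IsNormalDomain (σ 0) tetrad N
  /-- The Killing field is defined and timelike along the whole Fermi surface. -/
  surface_mem : ∀ l ∈ N, l 0 = 0 → g.normalMap (σ 0) tetrad l ∈ U
  /-- The space-time metric restricts to a Riemannian metric on the Fermi surface: it is positive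
  on the nonzero tangent vectors of the surface. -/
  surface_spacelike : ∀ l ∈ N, l 0 = 0 → ∀ v : E4, v 0 = 0 → v ≠ 0 →
    0 < g.form (g.normalMap (σ 0) tetrad l)
      (mfderiv 𝓘(ℝ, E4) 𝓘(ℝ, E4) (g.normalMap (σ 0) tetrad) l v)
      (mfderiv 𝓘(ℝ, E4) 𝓘(ℝ, E4) (g.normalMap (σ 0) tetrad) l v)

namespace KillingObserver

attribute [instance] top t2 charted manifold

variable {c : ℝ} (S : KillingObserver.{u} c)

/-- The Fermi surface `{p : g(exp⁻¹ p, σ'(0)) = 0}`, where `exp⁻¹` is the inverse of the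
exponential map at `σ 0` on the normal neighbourhood. -/
def fermiSurface : Set S.M :=
  {p | ∃ l ∈ S.N, S.g.normalMap (S.σ 0) S.tetrad l = p ∧
    S.g.form (S.σ 0) (∑ a, l a • S.tetrad a) (S.K (S.σ 0)) = 0}

/-- The vector `(0, x¹, x², x³)`. -/
def spatial (x : E3) : E4 := WithLp.toLp 2 (Fin.cons 0 x.ofLp : Fin 4 → ℝ)

/-- The point of the Fermi surface with Fermi coordinates `(0, x¹, x², x³)`. -/
def fermiPoint (x : E3) : S.M := S.g.normalMap (S.σ 0) S.tetrad (spatial x)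

/-- The Fermi surface in the Fermi coordinates `(x¹, x², x³)`. -/
def fermiDomain : Set E3 := {x | spatial x ∈ S.N}

lemma image_fermiDomain : S.fermiPoint '' S.fermiDomain = S.fermiSurface := by
  have key : ∀ l : E4, S.g.form (S.σ 0) (∑ a, l a • S.tetrad a) (S.K (S.σ 0)) = -c ^ 2 * l 0 := by
    intro l
    rw [← S.tetrad_zero]
    simp [Fin.sum_univ_succ, S.tetrad_orthonormal, map_add]
    ring
  have hc : c ≠ 0 := by
    rintro rfl
    have h1 := S.timelike _ (S.σ_mem 0 S.zero_mem_J)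
    rw [S.σ_proper 0 S.zero_mem_J] at h1
    simp at h1
  ext p
  constructor
  · rintro ⟨x, hx, rfl⟩
    exact ⟨_, hx, rfl, by rw [key]; simp [spatial]⟩
  · rintro ⟨l, hl, rfl, h0⟩
    rw [key] at h0
    have h0 : l 0 = 0 := by simpa [hc] using h0
    have h1 : spatial (WithLp.toLp 2 fun i : Fin 3 => l i.succ) = l := by
      ext i
      refine Fin.cases ?_ (fun j => ?_) i <;> simp [spatial, h0]
    exact ⟨WithLp.toLp 2 fun i => l i.succ, by simpa [fermiDomain, h1] using hl,
      by rw [fermiPoint, h1]⟩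

/-- The norm `‖K‖` of the Killing field, as a function of Fermi coordinates. -/
def killingNorm (x : E3) : ℝ :=
  √(-S.g.form (S.fermiPoint x) (S.K (S.fermiPoint x)) (S.K (S.fermiPoint x)))

/-- `α = ‖K‖ / c`. -/
def alpha (x : E3) : ℝ := S.killingNorm x / c

/-- The components of the induced metric `³g` in Fermi coordinates. -/
def inducedMetric (x : E3) : Matrix (Fin 3) (Fin 3) ℝ := Matrix.of fun i j =>
  S.g.form (S.fermiPoint x)
    (mfderiv 𝓘(ℝ, E3) 𝓘(ℝ, E4) S.fermiPoint x (EuclideanSpace.single i (1 : ℝ)))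
    (mfderiv 𝓘(ℝ, E3) 𝓘(ℝ, E4) S.fermiPoint x (EuclideanSpace.single j (1 : ℝ)))

/-- The proper volume, with respect to `³g`, of a region of the Fermi surface given in Fermi
coordinates. -/
def properVolume (A : Set E3) : ℝ := ∫ x in A, √(S.inducedMetric x).det

end KillingObserver

/-! ### The relativistic and the Newtonian ideal gas -/

/-- The modified Bessel function of the second kind of order two,
`K₂(r) = ∫₀^∞ exp(-r cosh t) cosh(2t) dt` for `r > 0`. -/
def besselK2 (r : ℝ) : ℝ := ∫ t in Ioi (0 : ℝ), Real.exp (-r * Real.cosh t) * Real.cosh (2 * t)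

/-- The physical parameters of the gas. -/
structure GasParameters where
  /-- Particle mass. -/
  m : ℝ
  /-- Inverse temperature. -/
  β : ℝ
  /-- Reduced Planck constant. -/
  hbar : ℝ
  /-- Gravitational constant. -/
  G : ℝ
  /-- Chemical potential. -/
  chem : ℝ
  m_pos : 0 < m
  β_pos : 0 < β
  hbar_pos : 0 < hbar
  G_pos : 0 < G

namespace GasParameters

variable (P : GasParameters)

/-- `z = 4π (mc)³ / (2πħ)³ · exp(β(mc² + μ))`. -/
def relActivity (c : ℝ) : ℝ :=
  4 * Real.pi * (P.m * c) ^ 3 / (2 * Real.pi * P.hbar) ^ 3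
    * Real.exp (P.β * (P.m * c ^ 2 + P.chem))

/-- `z_Newt = (m / (2πħ²β))^{3/2} exp(βμ)`. -/
def newtonActivity : ℝ :=
  (P.m / (2 * Real.pi * P.hbar ^ 2 * P.β)) ^ (3 / 2 : ℝ) * Real.exp (P.β * P.chem)

/-- The one-body potential defined by `exp(-β φ₁) = K₂(γ)/γ`, where `γ = ‖K‖ β m c`. -/
def relOneBody {c : ℝ} (S : KillingObserver.{u} c) (x : E3) : ℝ :=
  let γ : ℝ := S.killingNorm x * P.β * P.m * c;
  -(1 / P.β) * Real.log (besselK2 γ / γ)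

/-- The relativistic ideal gas on the Fermi surface, whose Fermi coordinates range over `D`, with
Lebesgue measure in these coordinates as the one-particle volume `dx`. The vacuum energy of a
region is its proper volume times `ρ_vac = λ c⁴ / (8πG)`. -/
def relativisticGas {c : ℝ} (S : KillingObserver.{u} c) (D : Set E3) : GrandCanonical D where
  dx := (volume : Measure E3).comap Subtype.val
  beta := P.β
  activity := P.relActivity c
  vacuumEnergy A := S.properVolume ((↑) '' A) * (S.cosmological * c ^ 4 / (8 * Real.pi * P.G))
  potential := GrandCanonical.idealPotential fun x : D => P.relOneBody S x

/-- The Newtonian ideal gas on `D` in an external field with one-body potential energy `W`. -/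
def newtonianGas (D : Set E3) (W : E3 → ℝ) : GrandCanonical D where
  dx := (volume : Measure E3).comap Subtype.val
  beta := P.β
  activity := P.newtonActivity
  vacuumEnergy _ := 0
  potential := GrandCanonical.idealPotential fun x : D => W x

end GasParameters

end

/-! Without interaction the energy of `x` in `S` is the vacuum energy plus a sum of one-body terms
over the particles of `x`, whatever the boundary condition. The vacuum factor cancels in the
normalization. With intensity `ρ = z e^{-β φ₁} dx`, the specification in `S` therefore puts a
Poisson configuration of intensity `ρ` restricted to `S` next to the part of `s` outside `S`
(`specification_eq_poissonLaw`).

A law on configurations is determined by its void probabilities (`ext_of_voidEvent`), and the DLR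
equations amount to saying that the probability of no particle in `T` is `e^{-ρ(T)}`
(`isGibbsState_iff`). This gives uniqueness. Existence is the existence of the Poisson process with
a locally finite intensity (`exists_poissonProcess`).

On an event observable in a bounded `T`, the Gibbs state is a finite Poisson law on `T`
(`IsGibbsState.apply_of_localSigma`), that is, a series of integrals of products of one-particle
densities. Dominated convergence reduces the limit to bounded pointwise convergence of the densities
on `T` (`tendsto_poissonLaw_withDensity`).

For the densities, `γ = β m c² α` and `K₂(γ) ~ √(π/(2γ)) e^{-γ}` (`tendsto_scaledBesselK2`). The
rest energy in the activity compensates `e^{-γ}` up to `exp(β m c² (1 - α))`, and the powers of `c`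
cancel. Since `α = 1` and `∂_y α = 0` at `y = 0`, Taylor's formula at `y = 1/c` sends `c² (1 - α)`
to `-∂_y² α(0, x) / 2`, which yields the Newtonian potential. The remainder is controlled uniformly
on the compact closure of `T`. -/

noncomputable section

/-! ### Bounded Borel sets -/

section BoundedBorel

variable {X : Type*} [TopologicalSpace X] [MeasurableSpace X]

lemma BoundedBorel.subset [R1Space X] {S T : Set X} (hS : S ∈ BoundedBorel X)
    (hT : MeasurableSet T) (h : T ⊆ S) : T ∈ BoundedBorel X :=
  ⟨hT, hS.2.of_isClosed_subset isClosed_closure (closure_mono h)⟩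

lemma BoundedBorel.union {S T : Set X} (hS : S ∈ BoundedBorel X) (hT : T ∈ BoundedBorel X) :
    S ∪ T ∈ BoundedBorel X :=
  ⟨hS.1.union hT.1, by rw [closure_union]; exact hS.2.union hT.2⟩

lemma BoundedBorel.empty : (∅ : Set X) ∈ BoundedBorel X := ⟨.empty, by simp⟩

end BoundedBorel

open MeasurableSpace in
-- Each of the finitely many pairs of distinct points is separated by some coordinate, so the
-- coordinates up to the largest one needed suffice.
lemma MeasurableSpace.exists_injOn_mapNatBool {X : Type*} [MeasurableSpace X] [CountablyGenerated X] [SeparatesPoints X] {F : Set X}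
    (hF : F.Finite) : ∃ n : ℕ, InjOn (fun a (i : Fin n) => mapNatBool X a i) F := by
  have h : ∀ p : X × X, ∃ i : ℕ, p.1 ≠ p.2 → mapNatBool X p.1 i ≠ mapNatBool X p.2 i := by
    intro p
    by_cases hp : p.1 = p.2
    · exact ⟨0, fun h => (h hp).elim⟩
    · have := (injective_mapNatBool X).ne hp
      obtain ⟨i, hi⟩ := Function.ne_iff.mp this
      exact ⟨i, fun _ => hi⟩
  choose g hg using h
  obtain ⟨N, hN⟩ := ((hF.prod hF).image g).bddAbove
  refine ⟨N + 1, fun a ha b hb hab => ?_⟩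
  by_contra hne
  have hle : g (a, b) ≤ N := hN ⟨(a, b), ⟨ha, hb⟩, rfl⟩
  exact hg (a, b) hne (congrFun hab ⟨g (a, b), by omega⟩)

namespace Configuration

variable {X : Type*} [TopologicalSpace X]

/-! ### The σ-algebra of configurations is generated by the void events -/

/-- The event that there is no particle in `T`. -/
def voidEvent (T : Set X) : Set (Configuration X) := {x | Disjoint x.carrier T}

lemma finite_inter (x : Configuration X) {T : Set X} (hT : IsCompact (closure T)) :
    (x.carrier ∩ T).Finite :=
  (x.finite_inter_compact _ hT).subset (inter_subset_inter_right _ subset_closure)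

lemma voidEvent_eq_count {T : Set X} (hT : IsCompact (closure T)) :
    voidEvent T = count T ⁻¹' {0} := by
  ext x
  simp only [voidEvent, mem_ofPred_eq, mem_preimage, mem_singleton_iff, count,
    ncard_eq_zero (x.finite_inter hT), disjoint_iff_inter_eq_empty]

lemma voidEvent_inter (S T : Set X) : voidEvent S ∩ voidEvent T = voidEvent (S ∪ T) := by
  ext x
  simp [voidEvent, disjoint_union_right]

lemma preimage_outside_voidEvent (S T : Set X) :
    outside S ⁻¹' voidEvent T = voidEvent (T \ S) := by
  ext x
  simp only [outside, voidEvent, mem_preimage, mem_ofPred_eq, disjoint_left, mem_inter_iff,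
    mem_compl_iff, Set.mem_sdiff]
  tauto

variable [MeasurableSpace X]

lemma measurable_count {T : Set X} (hT : T ∈ BoundedBorel X) :
    Measurable (count T : Configuration X → ℕ) :=
  Measurable.mono (comap_measurable (m := ⊤) (count T))
    (le_iSup₂_of_le (f := fun T (_ : T ∈ {T : Set X | T ∈ BoundedBorel X ∧ T ⊆ univ}) =>
      MeasurableSpace.comap (count T) ⊤) T ⟨hT, subset_univ T⟩ le_rfl) le_top

lemma measurableSet_voidEvent {T : Set X} (hT : T ∈ BoundedBorel X) :
    MeasurableSet (voidEvent T) := by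
  rw [voidEvent_eq_count hT.2]
  exact measurable_count hT (measurableSet_singleton 0)

lemma isPiSystem_voidEvent : IsPiSystem (voidEvent '' BoundedBorel X) := by
  rintro _ ⟨S, hS, rfl⟩ _ ⟨T, hT, rfl⟩ -
  exact ⟨S ∪ T, BoundedBorel.union hS hT, (voidEvent_inter S T).symm⟩

open Classical in
-- Partition `X` into finitely many cells by the first `n` binary coordinates. The number of
-- occupied cells never exceeds the count in `T`, and equals it once `n` is large enough to separate
-- the particles. The σ-algebra `m` is arbitrary so that it can be the one generated by the void
-- events.
lemma measurable_count_of_voidEvent [T2Space X] [MeasurableSpace.CountablyGenerated X]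
    [MeasurableSpace.SeparatesPoints X] {m : MeasurableSpace (Configuration X)}
    (hm : ∀ T ∈ BoundedBorel X, MeasurableSet[m] (voidEvent T)) {T : Set X}
    (hT : T ∈ BoundedBorel X) : Measurable[m] (count T : Configuration X → ℕ) := by
  let f : (n : ℕ) → X → (Fin n → Bool) := fun n a i => MeasurableSpace.mapNatBool X a i
  have hf : ∀ n, Measurable (f n) := fun n => measurable_pi_lambda _ fun i =>
    (measurable_pi_apply (i : ℕ)).comp (MeasurableSpace.measurable_mapNatBool X)
  have hc : ∀ n, Measurable[m] fun x : Configuration X => (f n '' (x.carrier ∩ T)).ncard := by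
    intro n
    -- A cell contributes 1 exactly when the configuration is not in its void event.
    have h : (fun x : Configuration X => (f n '' (x.carrier ∩ T)).ncard) =
        fun x => ∑ b : Fin n → Bool, if x ∈ voidEvent (T ∩ f n ⁻¹' {b}) then 0 else 1 := by
      funext x
      rw [ncard_eq_toFinset_card', Finset.card_eq_sum_ones, ← Finset.sum_filter_ne_zero,
        Finset.sum_ite, Finset.sum_const_zero, zero_add]
      simp only [ne_eq, one_ne_zero, not_false_eq_true, Finset.filter_true]
      refine Finset.sum_congr ?_ fun _ _ => rfl
      ext b
      simp only [mem_toFinset, voidEvent, mem_image, Finset.mem_filter, Finset.mem_univ, true_and,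
        mem_ofPred_eq, Set.not_disjoint_iff, mem_inter_iff, mem_preimage, mem_singleton_iff]
      exact ⟨fun ⟨a, ⟨h1, h2⟩, h3⟩ => ⟨a, h1, h2, h3⟩, fun ⟨a, h1, h2, h3⟩ => ⟨a, ⟨h1, h2⟩, h3⟩⟩
    rw [h]
    refine Finset.measurable_sum _ fun b _ => Measurable.ite ?_ measurable_const measurable_const
    exact hm _ (BoundedBorel.subset hT (hT.1.inter (hf n (measurableSet_singleton b))) inter_subset_left)
  refine measurable_of_Ici fun k => ?_
  have h : count T ⁻¹' Ici k =
      ⋃ n, (fun x : Configuration X => (f n '' (x.carrier ∩ T)).ncard) ⁻¹' Ici k := by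
    ext x
    have hfin := x.finite_inter hT.2
    simp only [mem_preimage, mem_Ici, mem_iUnion]
    constructor
    · intro hk
      obtain ⟨n, hn⟩ := MeasurableSpace.exists_injOn_mapNatBool hfin
      exact ⟨n, hk.trans hn.ncard_image.ge⟩
    · rintro ⟨n, hn⟩
      exact hn.trans (ncard_image_le hfin)
  rw [h]
  exact MeasurableSet.iUnion fun n => hc n measurableSet_Ici

variable [T2Space X] [MeasurableSpace.CountablyGenerated X] [MeasurableSpace.SeparatesPoints X]

lemma generateFrom_voidEvent :
    (instMeasurableSpace : MeasurableSpace (Configuration X)) =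
      MeasurableSpace.generateFrom (voidEvent '' BoundedBorel X) := by
  refine le_antisymm (iSup₂_le fun T hT => ?_) (MeasurableSpace.generateFrom_le ?_)
  · rw [← measurable_iff_comap_le]
    exact measurable_count_of_voidEvent
      (fun S hS => MeasurableSpace.measurableSet_generateFrom (mem_image_of_mem _ hS)) hT.1
  · rintro _ ⟨T, hT, rfl⟩
    exact measurableSet_voidEvent hT

/-- A map into configurations is measurable if the preimages of the void events are. -/
lemma measurable_of_voidEvent {Ω : Type*} [MeasurableSpace Ω] {f : Ω → Configuration X}
    (h : ∀ T ∈ BoundedBorel X, MeasurableSet (f ⁻¹' voidEvent T)) : Measurable f := by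
  rw [generateFrom_voidEvent]
  refine measurable_generateFrom ?_
  rintro _ ⟨T, hT, rfl⟩
  exact h T hT

/-- The law of a point process is determined by its void probabilities. -/
lemma ext_of_voidEvent {μ ν : Measure (Configuration X)} [IsProbabilityMeasure μ]
    [IsProbabilityMeasure ν] (h : ∀ T ∈ BoundedBorel X, μ (voidEvent T) = ν (voidEvent T)) :
    μ = ν := by
  refine ext_of_generate_finite _ generateFrom_voidEvent isPiSystem_voidEvent ?_ (by simp)
  rintro _ ⟨T, hT, rfl⟩
  exact h T hT

lemma measurable_ofTuple (n : ℕ) : Measurable (ofTuple : (Fin n → X) → Configuration X) := by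
  refine measurable_of_voidEvent fun T hT => ?_
  have h : ofTuple ⁻¹' voidEvent T = univ.pi fun _ : Fin n => Tᶜ := by
    ext v
    simp [ofTuple, voidEvent, disjoint_left]
  rw [h]
  exact MeasurableSet.univ_pi fun _ => hT.1.compl

lemma measurable_union :
    Measurable fun p : Configuration X × Configuration X => p.1.union p.2 := by
  refine measurable_of_voidEvent fun T hT => ?_
  have h : (fun p : Configuration X × Configuration X => p.1.union p.2) ⁻¹' voidEvent T =
      voidEvent T ×ˢ voidEvent T := by
    ext p
    simp [union, voidEvent, disjoint_union_left]
  rw [h]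
  exact (measurableSet_voidEvent hT).prod (measurableSet_voidEvent hT)

lemma measurable_outside {S : Set X} (hS : MeasurableSet S) :
    Measurable (outside S : Configuration X → Configuration X) := by
  refine measurable_of_voidEvent fun T hT => ?_
  rw [preimage_outside_voidEvent]
  exact measurableSet_voidEvent (BoundedBorel.subset hT (hT.1.diff hS) sdiff_subset)

/-! ### Poisson point processes -/

end Configuration

lemma ENNReal.tsum_ofReal_pow_div_factorial {a : ℝ≥0∞} (ha : a ≠ ⊤) :
    ∑' n : ℕ, ENNReal.ofReal (1 / n.factorial) * a ^ n = ENNReal.ofReal (Real.exp a.toReal) := by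
  have h : ∀ n : ℕ, ENNReal.ofReal (1 / n.factorial) * a ^ n =
      ENNReal.ofReal (a.toReal ^ n / n.factorial) := by
    intro n
    conv_lhs => rw [← ENNReal.ofReal_toReal ha, ← ENNReal.ofReal_pow ENNReal.toReal_nonneg,
      ← ENNReal.ofReal_mul (by positivity)]
    congr 1
    ring
  simp_rw [h]
  rw [← ENNReal.ofReal_tsum_of_nonneg (fun n => by positivity)
    (Real.summable_pow_div_factorial _), Real.exp_eq_exp_ℝ, NormedSpace.exp_eq_tsum_div]

namespace Configuration

variable {X : Type*} [TopologicalSpace X] [MeasurableSpace X]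

/-- The law of the Poisson point process with finite intensity measure `ν`. -/
def poissonLaw (ν : Measure X) : Measure (Configuration X) :=
  ENNReal.ofReal (Real.exp (-(ν univ).toReal)) • Measure.sum fun n : ℕ =>
    ENNReal.ofReal (1 / n.factorial) • (Measure.pi fun _ : Fin n => ν).map ofTuple

variable [T2Space X] [MeasurableSpace.CountablyGenerated X] [MeasurableSpace.SeparatesPoints X]

lemma poissonLaw_apply (ν : Measure X) {A : Set (Configuration X)} (hA : MeasurableSet A) :
    poissonLaw ν A = ENNReal.ofReal (Real.exp (-(ν univ).toReal)) * ∑' n : ℕ,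
      ENNReal.ofReal (1 / n.factorial) * (Measure.pi fun _ : Fin n => ν) (ofTuple ⁻¹' A) := by
  simp only [poissonLaw, Measure.smul_apply, smul_eq_mul, Measure.sum_apply _ hA,
    Measure.map_apply (measurable_ofTuple _) hA]

/-- The `n`-tuples avoiding `T` have mass `ν(Tᶜ)ⁿ`, so the series sums to `e^{ν(Tᶜ)}`, and the
normalization `e^{-ν(X)}` leaves `e^{-ν(T)}`. -/
lemma poissonLaw_voidEvent (ν : Measure X) [IsFiniteMeasure ν] {T : Set X}
    (hT : T ∈ BoundedBorel X) :
    poissonLaw ν (voidEvent T) = ENNReal.ofReal (Real.exp (-(ν T).toReal)) := by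
  rw [poissonLaw_apply ν (measurableSet_voidEvent hT)]
  have h : ∀ n : ℕ, (Measure.pi fun _ : Fin n => ν) (ofTuple ⁻¹' voidEvent T) = ν Tᶜ ^ n := by
    intro n
    have h : ofTuple ⁻¹' voidEvent T = univ.pi fun _ : Fin n => Tᶜ := by
      ext v
      simp [ofTuple, voidEvent, disjoint_left]
    rw [h, Measure.pi_pi]
    simp
  simp_rw [h]
  rw [ENNReal.tsum_ofReal_pow_div_factorial (measure_ne_top _ _),
    ← ENNReal.ofReal_mul (Real.exp_nonneg _), ← Real.exp_add, ← measure_add_measure_compl hT.1,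
    ENNReal.toReal_add (measure_ne_top _ _) (measure_ne_top _ _)]
  congr 2
  ring

instance (ν : Measure X) [IsFiniteMeasure ν] : IsProbabilityMeasure (poissonLaw ν) := by
  constructor
  have h := poissonLaw_voidEvent ν (BoundedBorel.empty (X := X))
  -- The void event of the empty set is the whole space.
  simpa [voidEvent] using h

variable [WeaklyLocallyCompactSpace X] [SigmaCompactSpace X] [OpensMeasurableSpace X]

/-- Existence of the Poisson point process with a locally finite intensity measure. -/
lemma exists_poissonProcess (ρ : Measure X) (hρ : ∀ T ∈ BoundedBorel X, ρ T ≠ ⊤) :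
    ∃ μ : Measure (Configuration X), IsProbabilityMeasure μ ∧
      ∀ T ∈ BoundedBorel X, μ (voidEvent T) = ENNReal.ofReal (Real.exp (-(ρ T).toReal)) := by
  let K : CompactExhaustion X := CompactExhaustion.choice X
  have hfind : Measurable K.find := measurable_of_Iic fun n => by
    have h : K.find ⁻¹' Iic n = K n := by
      ext a
      exact K.mem_iff_find_le.symm
    rw [h]
    exact (K.isCompact n).measurableSet
  -- The disjoint bounded layers of the exhaustion: independent finite Poisson processes on them are
  -- superposed.
  let B : ℕ → Set X := fun n => K.find ⁻¹' {n}
  have hBm : ∀ n, MeasurableSet (B n) := fun n => hfind (measurableSet_singleton n)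
  have hBb : ∀ n, B n ∈ BoundedBorel X := fun n =>
    BoundedBorel.subset ⟨(K.isCompact n).measurableSet, (K.isCompact n).closure⟩ (hBm n)
      fun a ha => K.mem_iff_find_le.mpr (le_of_eq ha)
  have hfin : ∀ n, IsFiniteMeasure (ρ.restrict (B n)) := fun n =>
    ⟨by simpa using (hρ _ (hBb n)).lt_top⟩
  -- Cutting `x n` down to `B n` makes the union locally finite for every sample, not merely almost
  -- surely.
  let Φ : (ℕ → Configuration X) → Configuration X := fun x =>
    { carrier := ⋃ n, (x n).carrier ∩ B n
      finite_inter_compact := fun C hC => by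
        obtain ⟨N, hN⟩ := K.exists_superset_of_isCompact hC
        refine ((finite_Iic N).biUnion fun n _ => (x n).finite_inter_compact C hC).subset ?_
        rintro a ⟨ha, haC⟩
        obtain ⟨n, hn, hnB⟩ := mem_iUnion.mp ha
        exact mem_biUnion (x := n) (hnB ▸ K.mem_iff_find_le.mp (hN haC)) ⟨hn, haC⟩ }
  -- A bounded set meets only finitely many layers, so its void event pulls back to a box in
  -- finitely many coordinates, whose probability is a finite product.
  have hΦ : ∀ T ∈ BoundedBorel X, ∃ N, T ⊆ K N ∧ Φ ⁻¹' voidEvent T =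
      (Finset.Iic N : Set ℕ).pi fun n => voidEvent (T ∩ B n) := by
    intro T hT
    obtain ⟨N, hN⟩ := K.exists_superset_of_isCompact hT.2
    have hTN : T ⊆ K N := subset_closure.trans hN
    refine ⟨N, hTN, ?_⟩
    ext x
    simp only [Φ, voidEvent, mem_preimage, mem_ofPred_eq, Set.mem_pi, Finset.mem_coe, Finset.mem_Iic,
      disjoint_iUnion_left]
    constructor
    · intro h n _
      rw [inter_comm T]
      exact disjoint_left.mpr fun a ha hb => disjoint_left.mp (h n) ⟨ha, hb.1⟩ hb.2
    · intro h n
      exact disjoint_left.mpr fun a ha hb => disjoint_left.mp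
        (h n (ha.2 ▸ K.mem_iff_find_le.mp (hTN hb))) ha.1 ⟨hb, ha.2⟩
  have hTB : ∀ T ∈ BoundedBorel X, ∀ n, T ∩ B n ∈ BoundedBorel X := fun T hT n =>
    BoundedBorel.subset hT (hT.1.inter (hBm n)) inter_subset_left
  have hΦm : Measurable Φ := measurable_of_voidEvent fun T hT => by
    obtain ⟨N, -, h⟩ := hΦ T hT
    rw [h]
    exact MeasurableSet.pi (Finset.countable_toSet _) fun n _ => measurableSet_voidEvent (hTB T hT n)
  refine ⟨(Measure.infinitePi fun n => poissonLaw (ρ.restrict (B n))).map Φ,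
    Measure.isProbabilityMeasure_map hΦm.aemeasurable, fun T hT => ?_⟩
  obtain ⟨N, hTN, h⟩ := hΦ T hT
  rw [Measure.map_apply hΦm (measurableSet_voidEvent hT), h,
    Measure.infinitePi_pi _ fun n _ => measurableSet_voidEvent (hTB T hT n)]
  have hval : ∀ n, poissonLaw (ρ.restrict (B n)) (voidEvent (T ∩ B n)) =
      ENNReal.ofReal (Real.exp (-(ρ (T ∩ B n)).toReal)) := fun n => by
    rw [poissonLaw_voidEvent _ (hTB T hT n), Measure.restrict_apply (hTB T hT n).1, inter_assoc,
      inter_self]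
  simp_rw [hval]
  rw [← ENNReal.ofReal_prod_of_nonneg fun n _ => Real.exp_nonneg _, ← Real.exp_sum,
    Finset.sum_neg_distrib, ← ENNReal.toReal_sum fun n _ => hρ _ (hTB T hT n),
    ← measure_biUnion_finset _ fun n _ => (hTB T hT n).1]
  · congr 5
    ext a
    simp only [mem_iUnion, Finset.mem_Iic, mem_inter_iff, exists_prop]
    exact ⟨fun ⟨n, _, h, _⟩ => h, fun ha => ⟨K.find a, K.mem_iff_find_le.mp (hTN ha), ha, rfl⟩⟩
  · intro i _ j _ hij
    exact disjoint_left.mpr fun a ha hb => hij (ha.2.symm.trans hb.2)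

end Configuration

/-! ### Finite product measures -/

section Pi

variable {X : Type*} [MeasurableSpace X]

lemma lintegral_pi_prod {n : ℕ} (ν : Fin n → Measure X) [∀ i, SigmaFinite (ν i)]
    {f : Fin n → X → ℝ≥0∞} (hf : ∀ i, Measurable (f i)) :
    ∫⁻ v, ∏ i, f i (v i) ∂Measure.pi ν = ∏ i, ∫⁻ p, f i p ∂ν i := by
  induction n with
  | zero => simp
  | succ n ih =>
    have hm : Measurable fun v : Fin (n + 1) → X => ∏ i, f i (v i) :=
      Finset.measurable_prod _ fun i _ => (hf i).comp (measurable_pi_apply i)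
    rw [← ((measurePreserving_piFinSuccAbove ν 0).symm).lintegral_comp hm, Fin.prod_univ_succ]
    have h : ∀ q : X × (Fin n → X),
        ∏ i, f i (((MeasurableEquiv.piFinSuccAbove (fun _ => X) 0).symm q) i) =
          f 0 q.1 * ∏ i : Fin n, f i.succ (q.2 i) := by
      intro q
      rw [Fin.prod_univ_succ]
      simp [MeasurableEquiv.piFinSuccAbove, Fin.insertNthEquiv]
    simp_rw [h]
    have hm' : Measurable fun w : Fin n → X => ∏ i : Fin n, f i.succ (w i) :=
      Finset.measurable_prod _ fun i _ => (hf i.succ).comp (measurable_pi_apply i)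
    rw [lintegral_prod_mul (f := f 0) (g := fun w : Fin n → X => ∏ i : Fin n, f i.succ (w i))
      (hf 0).aemeasurable hm'.aemeasurable]
    simp only [Fin.zero_succAbove]
    rw [ih (f := fun i => f i.succ) (fun i => ν i.succ) fun i => hf i.succ]

lemma MeasureTheory.Measure.pi_withDensity {n : ℕ} (ν : Measure X) [SigmaFinite ν] {f : X → ℝ≥0∞}
    (hf : Measurable f) [SigmaFinite (ν.withDensity f)] :
    (Measure.pi fun _ : Fin n => ν.withDensity f) =
      (Measure.pi fun _ : Fin n => ν).withDensity fun v => ∏ i, f (v i) := by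
  refine Measure.pi_eq fun s hs => ?_
  rw [withDensity_apply _ (MeasurableSet.univ_pi hs), ← lintegral_indicator (MeasurableSet.univ_pi hs)]
  have h : ∀ v : Fin n → X, (univ.pi s).indicator (fun v => ∏ i, f (v i)) v =
      ∏ i, (s i).indicator f (v i) := by
    intro v
    by_cases hv : v ∈ univ.pi s
    · rw [indicator_of_mem hv]
      exact Finset.prod_congr rfl fun i _ => (indicator_of_mem (hv i (mem_univ i)) f).symm
    · rw [indicator_of_notMem hv]
      simp only [Set.mem_pi, mem_univ, true_imp_iff, not_forall] at hv
      obtain ⟨i, hi⟩ := hv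
      exact (Finset.prod_eq_zero (Finset.mem_univ i) (indicator_of_notMem hi f)).symm
  simp_rw [h]
  rw [lintegral_pi_prod _ fun i => hf.indicator (hs i)]
  exact Finset.prod_congr rfl fun i _ => by
    rw [lintegral_indicator (hs i), withDensity_apply _ (hs i)]

/-- By Fubini each diagonal `v i = v j` is null, because its slice at fixed `v i` is a hyperplane.
Hence the restriction to pairwise distinct points in `ν_S` costs nothing. -/
lemma ae_injective_pi [MeasurableEq X] (n : ℕ) (ν : Measure X) [SigmaFinite ν]
    [NullSingletonClass ν] : ∀ᵐ v ∂(Measure.pi fun _ : Fin n => ν), Function.Injective v := by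
  have key : ∀ i j : Fin n, i ≠ j → ∀ᵐ v ∂(Measure.pi fun _ : Fin n => ν), v i ≠ v j := by
    intro i j hij
    cases n with
    | zero => exact i.elim0
    | succ n =>
      obtain ⟨k, rfl⟩ := Fin.exists_succAbove_eq hij.symm
      have hmp := measurePreserving_piFinSuccAbove (fun _ : Fin (n + 1) => ν) i
      have hms : MeasurableSet {q : X × (Fin n → X) | q.1 = q.2 k} :=
        measurableSet_eq_fun measurable_fst (by fun_prop)
      have h : ∀ᵐ q ∂(ν.prod (Measure.pi fun _ : Fin n => ν)), q.1 ≠ q.2 k := by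
        refine (Measure.ae_prod_iff_ae_ae hms.compl).mpr (ae_of_all _ fun a => ?_)
        have := Measure.pi_hyperplane (fun _ : Fin n => ν) k a
        rw [ae_iff]
        simpa [eq_comm] using this
      filter_upwards [hmp.quasiMeasurePreserving.ae h] with v hv
      exact hv
  have h : ∀ᵐ v ∂(Measure.pi fun _ : Fin n => ν), ∀ i j, i ≠ j → v i ≠ v j := by
    simp only [ae_all_iff]
    exact key
  filter_upwards [h] with v hv i j hij
  by_contra hne
  exact hv i j hne hij

end Pi

/-! ### The specification of an ideal gas -/

namespace GrandCanonical

lemma idealPotential_ne_top {X : Type*} (φ : X → ℝ) (y : Finset X) : idealPotential φ y ≠ ⊤ := by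
  unfold idealPotential
  split_ifs
  · exact WithTop.coe_ne_top
  · exact WithTop.zero_ne_top

lemma idealPotential_singleton {X : Type*} (φ : X → ℝ) (p : X) : (idealPotential φ {p}).untopD 0 = φ p := by
  simp [idealPotential]

variable {X : Type*} [TopologicalSpace X]

open Classical in
-- Only singletons carry energy, and a singleton cluster meeting `x` is a point of `x`. Even when
-- `s` is infinite the sum has finite support and does not see `s`.
lemma hasSum_idealPotential (φ : X → ℝ) (S : Set X) {x : Configuration X}
    (hx : x.carrier.Finite) (s : Configuration X) :
    HasSum (fun y : clusters S x s => (idealPotential φ (y : Finset X)).untopD 0)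
      (∑ p ∈ hx.toFinset, φ p) := by
  have h1 : ∑ p ∈ hx.toFinset, φ p = ∑ y ∈ hx.toFinset.image singleton,
      (clusters S x s).indicator (fun y => (idealPotential φ y).untopD 0) y := by
    rw [Finset.sum_image (by simp)]
    refine Finset.sum_congr rfl fun p hp => ?_
    have hp' : p ∈ x.carrier := by simpa using hp
    have hmem : ({p} : Finset X) ∈ clusters S x s :=
      ⟨by rw [Finset.coe_singleton]; exact singleton_subset_iff.mpr (Or.inl hp'),
        ⟨p, Finset.mem_coe.mpr (Finset.mem_singleton_self p), hp'⟩⟩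
    rw [indicator_of_mem hmem, idealPotential_singleton]
  rw [h1]
  refine (hasSum_subtype_iff_indicator (f := fun y : Finset X =>
    (idealPotential φ y).untopD 0)).mpr (hasSum_sum_of_ne_finset_zero fun y hy => ?_)
  by_contra hne
  have hmem := mem_of_indicator_ne_zero hne
  rw [indicator_of_mem hmem] at hne
  have hcard : y.card = 1 := by
    by_contra h
    simp [idealPotential, h] at hne
  obtain ⟨p, rfl⟩ := Finset.card_eq_one.mp hcard
  have hp : p ∈ x.carrier := by simpa using hmem.2
  exact hy (Finset.mem_image_of_mem _ (by simpa using hp))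

variable [MeasurableSpace X] (E : GrandCanonical X)

lemma energy_of_finite {φ : X → ℝ} (hE : E.potential = idealPotential φ) (S : Set X)
    {x : Configuration X} (hx : x.carrier.Finite) (s : Configuration X) :
    E.energy S x s = ((E.vacuumEnergy S + ∑ p ∈ hx.toFinset, φ p : ℝ) : WithTop ℝ) := by
  have h := hasSum_idealPotential φ S hx s
  rw [energy, hE, if_pos ⟨fun y _ => idealPotential_ne_top φ y, h.summable⟩, h.tsum_eq]

/-- Injectivity turns the sum over the set of particles into a sum over indices, so the Boltzmann
factor becomes a product. -/
lemma boltzmann_ofTuple {φ : X → ℝ} (hE : E.potential = idealPotential φ) (S : Set X)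
    (s : Configuration X) {n : ℕ} {v : Fin n → X} (hv : Function.Injective v) :
    boltzmann E.beta (E.energy S (Configuration.ofTuple v) s) =
      ENNReal.ofReal (Real.exp (-E.beta * E.vacuumEnergy S)) *
        ∏ i, ENNReal.ofReal (Real.exp (-E.beta * φ (v i))) := by
  classical
  have hx : (Configuration.ofTuple v).carrier.Finite := finite_range v
  rw [E.energy_of_finite hE S hx s]
  have h : ∑ p ∈ hx.toFinset, φ p = ∑ i, φ (v i) := by
    rw [← Finset.sum_image (s := Finset.univ) (g := v) fun i _ j _ h => hv h]
    exact Finset.sum_congr (by ext p; simp [Configuration.ofTuple]) fun _ _ => rfl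
  change ENNReal.ofReal (Real.exp (-E.beta * _)) = _
  rw [h, mul_add, Finset.mul_sum, Real.exp_add, Real.exp_sum,
    ENNReal.ofReal_mul (Real.exp_nonneg _), ENNReal.ofReal_prod_of_nonneg fun _ _ => Real.exp_nonneg _]

/-- The intensity measure `z e^{-β φ} dx` of an ideal gas with one-body potential `φ`. -/
def idealIntensity (φ : X → ℝ) : Measure X :=
  E.dx.withDensity fun p => ENNReal.ofReal (E.activity * Real.exp (-E.beta * φ p))

end GrandCanonical

/-! ### Measurability of sums over the particles in a bounded region -/

namespace Configuration

variable {X : Type*} [TopologicalSpace X] [MeasurableSpace X] [T2Space X]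
  [BorelSpace X]

/-- Evaluated on `T` this random measure is the count in `T ∩ S`. Integrating against it makes sums
over particles measurable in the configuration. -/
lemma measurable_count_restrict {S : Set X} (hS : S ∈ BoundedBorel X) :
    Measurable fun x : Configuration X => Measure.count.restrict (x.carrier ∩ S) := by
  refine Measure.measurable_of_measurable_coe _ fun T hT => ?_
  have h : (fun x : Configuration X => Measure.count.restrict (x.carrier ∩ S) T) =
      fun x => ((count (T ∩ S) x : ℕ) : ℝ≥0∞) := by
    funext x
    have hfin := x.finite_inter (BoundedBorel.subset hS (hT.inter hS.1) inter_subset_right).2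
    rw [Measure.restrict_apply hT, inter_left_comm, Measure.count_apply_finite _ hfin,
      ← ncard_eq_toFinset_card _ hfin, count]
  rw [h]
  exact (measurable_of_countable _).comp
    (measurable_count (BoundedBorel.subset hS (hT.inter hS.1) inter_subset_right))

lemma measurableSet_subset [SecondCountableTopology X] [SigmaCompactSpace X] {S : Set X} (hS : MeasurableSet S) :
    MeasurableSet {x : Configuration X | x.carrier ⊆ S} := by
  have h : {x : Configuration X | x.carrier ⊆ S} =
      ⋂ n, voidEvent (compactCovering X n \ S) := by
    ext x
    simp only [voidEvent, mem_iInter, mem_ofPred_eq, disjoint_left, Set.mem_sdiff, not_and, not_not]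
    refine ⟨fun h n a ha _ => h ha, fun h a ha => ?_⟩
    obtain ⟨n, hn⟩ := exists_mem_compactCovering a
    exact h n ha hn
  rw [h]
  refine MeasurableSet.iInter fun n => measurableSet_voidEvent ?_
  have hc := isCompact_compactCovering X n
  exact BoundedBorel.subset ⟨hc.measurableSet, hc.closure⟩ (hc.measurableSet.diff hS) sdiff_subset

end Configuration

namespace GrandCanonical

open Configuration

variable {X : Type*} [TopologicalSpace X] [MeasurableSpace X] [T2Space X]
  [SecondCountableTopology X] [BorelSpace X] (E : GrandCanonical X)

/-- The energy is defined by a case distinction and an unordered sum over clusters, so its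
measurability is not apparent. On configurations inside `S` it is a sum over particles, obtained
from the positive and negative parts of `φ` as two integrals against the random counting measure. -/
lemma exists_measurable_boltzmann {φ : X → ℝ} (hE : E.potential = idealPotential φ)
    (hφ : Measurable φ) {S : Set X} (hS : S ∈ BoundedBorel X) :
    ∃ G : Configuration X → ℝ≥0∞, Measurable G ∧ ∀ x : Configuration X, x.carrier ⊆ S →
      ∀ s, boltzmann E.beta (E.energy S x s) = G x := by
  let L : (X → ℝ≥0∞) → Configuration X → ℝ≥0∞ := fun f x =>
    ∫⁻ p in x.carrier ∩ S, f p ∂Measure.count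
  have hL : ∀ f, Measurable f → Measurable (L f) := fun f hf =>
    (Measure.measurable_lintegral hf).comp (measurable_count_restrict hS)
  have h1 := (hL _ hφ.ennreal_ofReal).ennreal_toReal
  have h2 := (hL _ hφ.neg.ennreal_ofReal).ennreal_toReal
  refine ⟨fun x => ENNReal.ofReal (Real.exp (-E.beta * (E.vacuumEnergy S +
    ((L (fun p => ENNReal.ofReal (φ p)) x).toReal -
      (L (fun p => ENNReal.ofReal (-φ p)) x).toReal)))), ?_, ?_⟩
  · exact (Real.measurable_exp.comp
      (((h1.sub h2).const_add _).const_mul _)).ennreal_ofReal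
  · intro x hxS s
    have hx : x.carrier.Finite := by
      have := x.finite_inter hS.2
      rwa [inter_eq_left.mpr hxS] at this
    have hsum : ∀ f : X → ℝ, (L (fun p => ENNReal.ofReal (f p)) x).toReal =
        ∑ p ∈ hx.toFinset, max (f p) 0 := by
      intro f
      have : L (fun p => ENNReal.ofReal (f p)) x = ∑ p ∈ hx.toFinset, ENNReal.ofReal (f p) := by
        simp only [L]
        rw [inter_eq_left.mpr hxS]
        conv_lhs => rw [← hx.coe_toFinset]
        rw [lintegral_finset]
        simp
      rw [this, ENNReal.toReal_sum fun _ _ => ENNReal.ofReal_ne_top]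
      rfl
    simp only
    rw [E.energy_of_finite hE S hx s, hsum φ, hsum fun p => -φ p, ← Finset.sum_sub_distrib]
    have : ∀ p, max (φ p) 0 - max (-φ p) 0 = φ p := fun p => by
      rcases le_total (φ p) 0 with h | h
      · rw [max_eq_right h, max_eq_left (by linarith)]; ring
      · rw [max_eq_left h, max_eq_right (by linarith)]; ring
    simp only [this]
    rfl

variable [SigmaCompactSpace X] [IsFiniteMeasureOnCompacts E.dx] [NullSingletonClass E.dx]

/-- On `n`-tuples the Boltzmann factor times `zⁿ` is the vacuum factor times a product of
one-particle densities, so it is absorbed into the `n`-fold product of the intensity. -/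
lemma lintegral_boltzmann {φ : X → ℝ} (hE : E.potential = idealPotential φ) (hφ : Measurable φ)
    (hz : 0 ≤ E.activity) {S : Set X} (hS : S ∈ BoundedBorel X)
    (hρ : E.idealIntensity φ S ≠ ⊤) (s : Configuration X) {A : Set (Configuration X)}
    (hA : MeasurableSet A) :
    ∫⁻ x, A.indicator 1 x * boltzmann E.beta (E.energy S x s) ∂E.poisson S =
      ENNReal.ofReal (Real.exp (-E.beta * E.vacuumEnergy S)) * ∑' n : ℕ,
        ENNReal.ofReal (1 / n.factorial) *
          (Measure.pi fun _ : Fin n => (E.idealIntensity φ).restrict S) (ofTuple ⁻¹' A) := by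
  obtain ⟨G, hG, hGe⟩ := E.exists_measurable_boltzmann hE hφ hS
  have hfin : IsFiniteMeasure (E.dx.restrict S) :=
    ⟨by simpa using (measure_mono subset_closure).trans_lt hS.2.measure_lt_top⟩
  have hfin' : IsFiniteMeasure ((E.idealIntensity φ).restrict S) := ⟨by simpa using hρ.lt_top⟩
  let f : X → ℝ≥0∞ := fun p => ENNReal.ofReal (E.activity * Real.exp (-E.beta * φ p))
  have hf : Measurable f :=
    ((Real.measurable_exp.comp (hφ.const_mul _)).const_mul _).ennreal_ofReal
  have hres : (E.idealIntensity φ).restrict S = (E.dx.restrict S).withDensity f :=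
    restrict_withDensity hS.1 f
  have hd : ∀ n, (Measure.pi fun _ : Fin n => E.dx).restrict (distinctTuples S n) =
      Measure.pi fun _ : Fin n => E.dx.restrict S := by
    intro n
    rw [Measure.restrict_congr_set, Measure.restrict_pi_pi]
    rw [Filter.eventuallyEq_set]
    filter_upwards [ae_injective_pi n E.dx] with v hv
    simp [distinctTuples, hv]
  have hinj : ∀ n, ∀ᵐ v ∂Measure.pi fun _ : Fin n => E.dx.restrict S,
      Function.Injective v ∧ ∀ i, v i ∈ S := by
    intro n
    refine (ae_injective_pi n _).and (ae_all_iff.mpr fun i => ?_)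
    exact (Measure.quasiMeasurePreserving_eval (fun _ : Fin n => E.dx.restrict S) i).ae
      (ae_restrict_mem hS.1)
  rw [poisson, lintegral_sum_measure, ← ENNReal.tsum_mul_left]
  refine tsum_congr fun n => ?_
  rw [lintegral_smul_measure, hd]
  -- The Boltzmann factor is exchanged for its measurable version, so that the integral can be
  -- pulled back to tuples.
  have hae : ∀ᵐ x ∂(Measure.pi fun _ : Fin n => E.dx.restrict S).map ofTuple,
      A.indicator 1 x * boltzmann E.beta (E.energy S x s) = A.indicator 1 x * G x := by
    have : ∀ᵐ x ∂(Measure.pi fun _ : Fin n => E.dx.restrict S).map ofTuple, x.carrier ⊆ S := by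
      rw [ae_map_iff (measurable_ofTuple n).aemeasurable (measurableSet_subset hS.1)]
      filter_upwards [hinj n] with v hv
      exact range_subset_iff.mpr hv.2
    filter_upwards [this] with x hx
    rw [hGe x hx s]
  rw [lintegral_congr_ae hae, lintegral_map (f := fun x => A.indicator 1 x * G x) ((measurable_one.indicator hA).mul hG)
    (measurable_ofTuple n), hres]
  have : SigmaFinite ((E.dx.restrict S).withDensity f) := by rw [← hres]; infer_instance
  rw [Measure.pi_withDensity _ hf, withDensity_apply _ (measurable_ofTuple n hA),
    ← lintegral_indicator (measurable_ofTuple n hA), smul_eq_mul, ← mul_assoc,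
    ← lintegral_const_mul', ← lintegral_const_mul']
  · refine lintegral_congr_ae ?_
    filter_upwards [hinj n] with v hv
    rw [← hGe _ (range_subset_iff.mpr hv.2) s, E.boltzmann_ofTuple hE S s hv.1]
    by_cases hvA : ofTuple v ∈ A
    · have hprod : ∏ i, f (v i) = ENNReal.ofReal E.activity ^ n *
          ∏ i, ENNReal.ofReal (Real.exp (-E.beta * φ (v i))) := by
        simp only [f, ENNReal.ofReal_mul hz, Finset.prod_mul_distrib, Finset.prod_const,
          Finset.card_univ, Fintype.card_fin]
      rw [indicator_of_mem hvA, indicator_of_mem (show v ∈ ofTuple ⁻¹' A from hvA), hprod,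
        div_eq_mul_one_div, ENNReal.ofReal_mul (pow_nonneg hz n), ENNReal.ofReal_pow hz]
      simp only [Pi.one_apply]
      ring
    · rw [indicator_of_notMem hvA, indicator_of_notMem (show v ∉ ofTuple ⁻¹' A from hvA)]
      simp
  · exact ENNReal.mul_ne_top ENNReal.ofReal_ne_top ENNReal.ofReal_ne_top
  · exact ENNReal.ofReal_ne_top

/-- The specification of an ideal gas is a Poisson law that ignores the boundary condition. -/
lemma specification_eq_poissonLaw {φ : X → ℝ} (hE : E.potential = idealPotential φ)
    (hφ : Measurable φ) (hz : 0 ≤ E.activity) {S : Set X} (hS : S ∈ BoundedBorel X)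
    (hρ : E.idealIntensity φ S ≠ ⊤) (s : Configuration X) {A : Set (Configuration X)}
    (hA : MeasurableSet A) :
    E.specification S A s = poissonLaw ((E.idealIntensity φ).restrict S)
      {x | x.union (s.outside S) ∈ A} := by
  have hA' : MeasurableSet {x : Configuration X | x.union (s.outside S) ∈ A} :=
    (measurable_union.comp (measurable_id.prodMk measurable_const)) hA
  have hfin : IsFiniteMeasure ((E.idealIntensity φ).restrict S) := ⟨by simpa using hρ.lt_top⟩
  -- The previous lemma with the sure event. The vacuum factor here is the one in the numerator, so
  -- it cancels.
  have hZ : E.partitionFunction S s = ENNReal.ofReal (Real.exp (-E.beta * E.vacuumEnergy S)) *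
      ENNReal.ofReal (Real.exp (E.idealIntensity φ S).toReal) := by
    have h := E.lintegral_boltzmann hE hφ hz hS hρ s MeasurableSet.univ
    simp only [indicator_univ, Pi.one_apply, one_mul, preimage_univ, Measure.pi_univ,
      Finset.prod_const, Finset.card_univ, Fintype.card_fin, Measure.restrict_apply_univ] at h
    rw [ENNReal.tsum_ofReal_pow_div_factorial hρ] at h
    exact h
  have hnum := E.lintegral_boltzmann hE hφ hz hS hρ s hA'
  have hZt : E.partitionFunction S s < ⊤ := by
    rw [hZ]
    exact ENNReal.mul_lt_top ENNReal.ofReal_lt_top ENNReal.ofReal_lt_top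
  rw [specification, if_pos hZt, poissonLaw_apply _ hA', Measure.restrict_apply_univ]
  change _ * ∫⁻ x, indicator {x : Configuration X | x.union (s.outside S) ∈ A} 1 x *
    boltzmann E.beta (E.energy S x s) ∂E.poisson S = _
  rw [hnum, hZ, ← mul_assoc, ← ENNReal.ofReal_mul (Real.exp_nonneg _),
    ← ENNReal.ofReal_inv_of_pos (by positivity), ← ENNReal.ofReal_mul (by positivity),
    Real.exp_neg (E.idealIntensity φ S).toReal]
  congr 2
  field_simp

/-! ### Gibbs states of an ideal gas -/

/-- A probability measure is a Gibbs state of an ideal gas if and only if its void probabilities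
are those of the Poisson process with intensity `z e^{-β φ} dx`. -/
lemma isGibbsState_iff {φ : X → ℝ} (hE : E.potential = idealPotential φ) (hφ : Measurable φ)
    (hz : 0 ≤ E.activity) (hρ : ∀ S ∈ BoundedBorel X, E.idealIntensity φ S ≠ ⊤)
    (μ : Measure (Configuration X)) :
    E.IsGibbsState μ ↔ IsProbabilityMeasure μ ∧ ∀ T ∈ BoundedBorel X, μ (voidEvent T) =
      ENNReal.ofReal (Real.exp (-(E.idealIntensity φ T).toReal)) := by
  have hfin : ∀ S ∈ BoundedBorel X, IsFiniteMeasure ((E.idealIntensity φ).restrict S) :=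
    fun S hS => ⟨by simpa using (hρ S hS).lt_top⟩
  refine and_congr_right fun hμ => ⟨fun h T hT => ?_, fun h S hS A hA => ?_⟩
  · rw [← h T hT _ (measurableSet_voidEvent hT)]
    -- The DLR equation in `T` itself already fixes the void probability: the boundary part lies
    -- outside `T`, so the integrand is constant in `s`.
    have hs : ∀ s, E.specification T (voidEvent T) s =
        ENNReal.ofReal (Real.exp (-(E.idealIntensity φ T).toReal)) := by
      intro s
      have := hfin T hT
      rw [E.specification_eq_poissonLaw hE hφ hz hT (hρ T hT) s (measurableSet_voidEvent hT)]
      have h1 : {x : Configuration X | x.union (s.outside T) ∈ voidEvent T} = voidEvent T := by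
        ext x
        simp only [voidEvent, Configuration.union, outside, mem_ofPred_eq, disjoint_union_left,
          and_iff_left_iff_imp]
        exact fun _ => disjoint_left.mpr fun a ha => ha.2
      rw [h1, poissonLaw_voidEvent _ hT, Measure.restrict_apply hT.1, inter_self]
    simp [hs]
  · have := hfin S hS
    let P := poissonLaw ((E.idealIntensity φ).restrict S)
    have hm : Measurable fun p : Configuration X × Configuration X => p.2.union (p.1.outside S) :=
      measurable_union.comp
        (measurable_snd.prodMk ((measurable_outside hS.1).comp measurable_fst))
    have hP : IsProbabilityMeasure ((μ.prod P).map
        fun p : Configuration X × Configuration X => p.2.union (p.1.outside S)) :=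
      Measure.isProbabilityMeasure_map hm.aemeasurable
    -- Conversely, the DLR integral is the law of an independent Poisson configuration on `S` joined
    -- to the part of a `μ`-sample outside `S`. Its void probabilities multiply, `ρ(T \ S) + ρ(T ∩
    -- S) = ρ(T)`, so this law is `μ`.
    have hmix : (μ.prod P).map
        (fun p : Configuration X × Configuration X => p.2.union (p.1.outside S)) = μ := by
      refine ext_of_voidEvent fun T hT => ?_
      have h1 : (fun p : Configuration X × Configuration X => p.2.union (p.1.outside S)) ⁻¹'
          voidEvent T = voidEvent (T \ S) ×ˢ voidEvent T := by
        ext p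
        have := Set.ext_iff.mp (preimage_outside_voidEvent S T) p.1
        simp only [mem_preimage] at this
        rw [mem_prod, ← this]
        simp only [voidEvent, Configuration.union, mem_preimage, mem_ofPred_eq,
          disjoint_union_left]
        exact and_comm
      have hTS : T \ S ∈ BoundedBorel X := BoundedBorel.subset hT (hT.1.diff hS.1) sdiff_subset
      rw [Measure.map_apply hm (measurableSet_voidEvent hT), h1, Measure.prod_prod, h _ hTS, h _ hT,
        poissonLaw_voidEvent _ hT, Measure.restrict_apply hT.1,
        ← ENNReal.ofReal_mul (Real.exp_nonneg _), ← Real.exp_add,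
        ← measure_inter_add_sdiff T hS.1, ENNReal.toReal_add
          (measure_ne_top_of_subset inter_subset_left (hρ T hT)) (hρ _ hTS)]
      congr 2
      ring
    conv_rhs => rw [← hmix]
    rw [Measure.map_apply hm hA, Measure.prod_apply (hm hA)]
    exact lintegral_congr fun s =>
      E.specification_eq_poissonLaw hE hφ hz hS (hρ S hS) s hA

lemma existsUnique_isGibbsState [WeaklyLocallyCompactSpace X] {φ : X → ℝ}
    (hE : E.potential = idealPotential φ) (hφ : Measurable φ) (hz : 0 ≤ E.activity)
    (hρ : ∀ S ∈ BoundedBorel X, E.idealIntensity φ S ≠ ⊤) :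
    ∃! μ : Measure (Configuration X), E.IsGibbsState μ := by
  simp only [E.isGibbsState_iff hE hφ hz hρ]
  obtain ⟨μ, hμ, h⟩ := exists_poissonProcess (E.idealIntensity φ) hρ
  refine ⟨μ, ⟨hμ, h⟩, fun μ' ⟨hμ', h'⟩ => ext_of_voidEvent fun T hT => ?_⟩
  rw [h T hT, h' T hT]

end GrandCanonical

/-! ### Restriction of a Gibbs state to local events -/

namespace Configuration

variable {X : Type*} [TopologicalSpace X] [MeasurableSpace X]

lemma localSigma_le (S : Set X) :
    localSigma S ≤ (instMeasurableSpace : MeasurableSpace (Configuration X)) :=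
  iSup₂_le fun T hT => le_iSup₂_of_le
    (f := fun T (_ : T ∈ {T : Set X | T ∈ BoundedBorel X ∧ T ⊆ univ}) =>
      MeasurableSpace.comap (count T) ⊤) T ⟨hT.1, subset_univ T⟩ le_rfl

/-- Events observable in `S` do not depend on the particles outside `S`. -/
lemma union_outside_mem_iff {S : Set X} {A : Set (Configuration X)}
    (hA : MeasurableSet[localSigma S] A) (x s : Configuration X) :
    x.union (s.outside S) ∈ A ↔ x ∈ A := by
  -- The events insensitive to particles outside `S` form a σ-algebra, so only the generating counts
  -- need checking.
  let m : MeasurableSpace (Configuration X) :=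
    { MeasurableSet' := fun A => ∀ x s, x.union (outside S s) ∈ A ↔ x ∈ A
      measurableSet_empty := by simp
      measurableSet_compl := fun A hA x s => not_congr (hA x s)
      measurableSet_iUnion := fun f hf x s => by simp [hf _ x s] }
  have h : localSigma S ≤ m := by
    refine iSup₂_le fun T hT => ?_
    rintro _ ⟨B, -, rfl⟩ x s
    have : count T (x.union (outside S s)) = count T x := by
      unfold count
      congr 1
      ext a
      simp only [Configuration.union, outside, mem_inter_iff, mem_union, mem_compl_iff]
      have := @hT.2 a
      tauto
    simp only [mem_preimage, this]
  exact h A hA x s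

end Configuration

namespace GrandCanonical

open Configuration

variable {X : Type*} [TopologicalSpace X] [MeasurableSpace X] [T2Space X]
  [SecondCountableTopology X] [BorelSpace X] [SigmaCompactSpace X]

/-- For an event observable in `S` the DLR integrand does not depend on `s`. The limit problem is
thereby reduced to finite intensity measures. -/
lemma IsGibbsState.apply_of_localSigma {E : GrandCanonical X} [IsFiniteMeasureOnCompacts E.dx]
    [NullSingletonClass E.dx] {φ : X → ℝ} (hE : E.potential = idealPotential φ) (hφ : Measurable φ)
    (hz : 0 ≤ E.activity) (hρ : ∀ S ∈ BoundedBorel X, E.idealIntensity φ S ≠ ⊤)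
    {μ : Measure (Configuration X)} (hμ : E.IsGibbsState μ) {S : Set X} (hS : S ∈ BoundedBorel X)
    {A : Set (Configuration X)} (hA : MeasurableSet[localSigma S] A) :
    μ A = poissonLaw ((E.idealIntensity φ).restrict S) A := by
  have hA' := localSigma_le S A hA
  have := hμ.1
  rw [← hμ.2 S hS A hA']
  simp_rw [E.specification_eq_poissonLaw hE hφ hz hS (hρ S hS) _ hA', union_outside_mem_iff hA]
  simp

end GrandCanonical

/-! ### Convergence of Poisson laws -/

namespace Configuration

variable {X ι : Type*} [TopologicalSpace X] [MeasurableSpace X] [T2Space X]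
  [MeasurableSpace.CountablyGenerated X] [MeasurableSpace.SeparatesPoints X]

/-- The series over particle numbers is written as an integral against counting measure so that
dominated convergence applies to it as well. -/
lemma poissonLaw_withDensity_apply (ν : Measure X) [SigmaFinite ν] {f : X → ℝ≥0∞}
    (hf : Measurable f) [SigmaFinite (ν.withDensity f)] {A : Set (Configuration X)}
    (hA : MeasurableSet A) :
    poissonLaw (ν.withDensity f) A = ENNReal.ofReal (Real.exp (-(∫⁻ p, f p ∂ν).toReal)) *
      ∫⁻ n : ℕ, ENNReal.ofReal (1 / n.factorial) *
        ∫⁻ v in ofTuple ⁻¹' A, ∏ i, f (v i) ∂(Measure.pi fun _ : Fin n => ν) ∂Measure.count := by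
  rw [poissonLaw_apply _ hA, lintegral_count, withDensity_apply _ MeasurableSet.univ,
    Measure.restrict_univ]
  congr 1
  refine tsum_congr fun n => ?_
  rw [Measure.pi_withDensity ν hf, withDensity_apply _ (measurable_ofTuple n hA)]

/-- If intensity densities converge boundedly, the probabilities of events under the Poisson laws
converge. -/
lemma tendsto_poissonLaw_withDensity (ν : Measure X) [IsFiniteMeasure ν] {l : Filter ι}
    [l.IsCountablyGenerated] {f : ι → X → ℝ≥0∞} {g : X → ℝ≥0∞} (hf : ∀ c, Measurable (f c))
    (hg : Measurable g) {C : ℝ≥0∞} (hC : C ≠ ⊤) (hfC : ∀ᶠ c in l, ∀ᵐ p ∂ν, f c p ≤ C)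
    (hgC : ∀ᵐ p ∂ν, g p ≤ C) (hlim : ∀ᵐ p ∂ν, Tendsto (fun c => f c p) l (𝓝 (g p)))
    {A : Set (Configuration X)} (hA : MeasurableSet A) :
    Tendsto (fun c => poissonLaw (ν.withDensity (f c)) A) l
      (𝓝 (poissonLaw (ν.withDensity g) A)) := by
  have hint : ∀ h : X → ℝ≥0∞, (∀ᵐ p ∂ν, h p ≤ C) → ∫⁻ p, h p ∂ν ≠ ⊤ := fun h hh =>
    ((lintegral_mono_ae hh).trans_lt (by
      rw [lintegral_const]
      exact ENNReal.mul_lt_top hC.lt_top (measure_lt_top _ _))).ne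
  have hfin : ∀ h : X → ℝ≥0∞, (∀ᵐ p ∂ν, h p ≤ C) → IsFiniteMeasure (ν.withDensity h) :=
    fun h hh => isFiniteMeasure_withDensity (hint h hh)
  have hpi : ∀ (n : ℕ) (h : X → ℝ≥0∞), (∀ᵐ p ∂ν, h p ≤ C) →
      ∀ᵐ v ∂Measure.pi fun _ : Fin n => ν, ∏ i, h (v i) ≤ C ^ n := by
    intro n h hh
    have : ∀ᵐ v ∂Measure.pi fun _ : Fin n => ν, ∀ i, h (v i) ≤ C := ae_all_iff.mpr fun i =>
      (Measure.quasiMeasurePreserving_eval (fun _ : Fin n => ν) i).ae hh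
    filter_upwards [this] with v hv
    simpa using Finset.prod_le_prod' (s := Finset.univ) fun i _ => hv i
  have hbound : ∀ (n : ℕ) (h : X → ℝ≥0∞), (∀ᵐ p ∂ν, h p ≤ C) →
      ∫⁻ v in ofTuple ⁻¹' A, ∏ i, h (v i) ∂(Measure.pi fun _ : Fin n => ν) ≤ (C * ν univ) ^ n := by
    intro n h hh
    refine (setLIntegral_le_lintegral _ _).trans ((lintegral_mono_ae (hpi n h hh)).trans ?_)
    rw [lintegral_const, Measure.pi_univ]
    simp [mul_pow]
  -- The dominating series is the exponential series of `C ν(X)`.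
  have hsum : ∫⁻ n : ℕ, ENNReal.ofReal (1 / n.factorial) * (C * ν univ) ^ n ∂Measure.count ≠ ⊤ := by
    rw [lintegral_count,
      ENNReal.tsum_ofReal_pow_div_factorial (ENNReal.mul_ne_top hC (measure_ne_top _ _))]
    exact ENNReal.ofReal_ne_top
  have := hfin g hgC
  rw [poissonLaw_withDensity_apply ν hg hA]
  have heq : ∀ᶠ c in l, ENNReal.ofReal (Real.exp (-(∫⁻ p, f c p ∂ν).toReal)) *
      ∫⁻ n : ℕ, ENNReal.ofReal (1 / n.factorial) *
        ∫⁻ v in ofTuple ⁻¹' A, ∏ i, f c (v i) ∂(Measure.pi fun _ : Fin n => ν) ∂Measure.count =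
      poissonLaw (ν.withDensity (f c)) A := by
    filter_upwards [hfC] with c hc
    have := hfin (f c) hc
    exact (poissonLaw_withDensity_apply ν (hf c) hA).symm
  refine Tendsto.congr' heq ?_
  refine ENNReal.Tendsto.mul ?_ (Or.inl (by simp [Real.exp_pos])) ?_
    (Or.inr ENNReal.ofReal_ne_top)
  · refine ENNReal.tendsto_ofReal ((Real.continuous_exp.tendsto _).comp (Tendsto.neg ?_))
    refine (ENNReal.tendsto_toReal (hint g hgC)).comp ?_
    exact tendsto_lintegral_filter_of_dominated_convergence (fun _ => C)
      (Eventually.of_forall hf) hfC (by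
        rw [lintegral_const]
        exact ENNReal.mul_ne_top hC (measure_ne_top _ _)) hlim
  · refine tendsto_lintegral_filter_of_dominated_convergence
      (fun n : ℕ => ENNReal.ofReal (1 / n.factorial) * (C * ν univ) ^ n)
      (Eventually.of_forall fun c => measurable_of_countable _) ?_ hsum (ae_of_all _ fun n => ?_)
    · filter_upwards [hfC] with c hc
      exact ae_of_all _ fun n => mul_le_mul_right (hbound n (f c) hc) _
    · refine ENNReal.Tendsto.const_mul ?_ (Or.inr ENNReal.ofReal_ne_top)
      refine tendsto_lintegral_filter_of_dominated_convergence (fun _ => C ^ n)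
        (Eventually.of_forall fun c => Finset.measurable_prod _ fun i _ =>
          (hf c).comp (measurable_pi_apply i)) ?_ ?_ ?_
      · filter_upwards [hfC] with c hc
        exact ae_restrict_of_ae (hpi n (f c) hc)
      · rw [lintegral_const]
        exact ENNReal.mul_ne_top (ENNReal.pow_ne_top hC) (measure_ne_top _ _)
      · have h : ∀ᵐ v ∂Measure.pi fun _ : Fin n => ν, ∀ i,
            Tendsto (fun c => f c (v i)) l (𝓝 (g (v i))) ∧ g (v i) ≤ C := ae_all_iff.mpr fun i =>
          (Measure.quasiMeasurePreserving_eval (fun _ : Fin n => ν) i).ae (hlim.and hgC)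
        refine ae_restrict_of_ae ?_
        filter_upwards [h] with v hv
        exact ENNReal.tendsto_finsetProd_of_ne_top _ (fun i _ => (hv i).1)
          fun i _ => ((hv i).2.trans_lt hC.lt_top).ne

end Configuration

/-! ### The modified Bessel function of order two -/

section Bessel

/-- From `cosh x = 1 + 2 sinh² (x/2)`. It supplies the Gaussian domination of the Bessel integrand.
-/
lemma one_add_sq_div_two_le_cosh (x : ℝ) : 1 + x ^ 2 / 2 ≤ Real.cosh x := by
  have h1 : Real.cosh x = 1 + 2 * Real.sinh (x / 2) ^ 2 := by
    have h := Real.cosh_two_mul (x / 2)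
    have h' := Real.cosh_sq (x / 2)
    rw [mul_div_cancel₀ x two_ne_zero] at h
    linarith
  have h2 : (x / 2) ^ 2 ≤ Real.sinh (x / 2) ^ 2 := by
    rw [sq_le_sq, Real.abs_sinh]
    exact Real.self_le_sinh_iff.mpr (abs_nonneg _)
  rw [h1]
  linarith

lemma cosh_two_mul_le_exp {x : ℝ} (hx : 0 ≤ x) : Real.cosh (2 * x) ≤ Real.exp (2 * x) := by
  have h := Real.cosh_add_sinh (2 * x)
  have h' := Real.sinh_nonneg_iff.mpr (mul_nonneg zero_le_two hx)
  linarith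

lemma integrableOn_gaussian_mul_cosh {r : ℝ} (hr : 0 < r) :
    IntegrableOn (fun t => Real.exp (-(r * t ^ 2 / 2)) * Real.cosh (2 * t)) (Ioi 0) := by
  -- Completing the square: `2t - r t²/2 ≤ 4/r - r t²/4`, because `(r t/2 - 2)²/r ≥ 0`.
  have h := ((integrable_exp_neg_mul_sq (b := r / 4) (by positivity)).const_mul
    (Real.exp (4 / r))).integrableOn (s := Ioi 0)
  refine Integrable.mono' h (by fun_prop) ?_
  filter_upwards [ae_restrict_mem measurableSet_Ioi] with t ht
  have ht : (0 : ℝ) < t := ht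
  rw [Real.norm_of_nonneg (by positivity), ← Real.exp_add]
  refine (mul_le_mul_of_nonneg_left (cosh_two_mul_le_exp ht.le) (Real.exp_nonneg _)).trans ?_
  rw [← Real.exp_add]
  refine Real.exp_le_exp.mpr ?_
  have h1 : 0 ≤ (r * t / 2 - 2) ^ 2 / r := by positivity
  have h2 : (r * t / 2 - 2) ^ 2 / r = r * t ^ 2 / 4 - 2 * t + 4 / r := by
    field_simp
    ring
  linarith

lemma integrableOn_besselK2 {r : ℝ} (hr : 0 < r) :
    IntegrableOn (fun t => Real.exp (-r * Real.cosh t) * Real.cosh (2 * t)) (Ioi 0) := by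
  refine Integrable.mono' (integrableOn_gaussian_mul_cosh hr) (by fun_prop) ?_
  filter_upwards with t
  rw [Real.norm_of_nonneg (by positivity)]
  refine mul_le_mul_of_nonneg_right (Real.exp_le_exp.mpr ?_) (by positivity)
  nlinarith [one_add_sq_div_two_le_cosh t]

lemma besselK2_pos {r : ℝ} (hr : 0 < r) : 0 < besselK2 r := by
  refine (setIntegral_pos_iff_support_of_nonneg_ae (ae_of_all _ fun t => by positivity)
    (integrableOn_besselK2 hr)).mpr ?_
  have h : Function.support (fun t => Real.exp (-r * Real.cosh t) * Real.cosh (2 * t)) = univ :=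
    eq_univ_of_forall fun t => by
      rw [Function.mem_support]
      positivity
  rw [h, univ_inter]
  simp

lemma continuousOn_besselK2 : ContinuousOn besselK2 (Ioi 0) := by
  intro r hr
  have hr : (0 : ℝ) < r := hr
  refine ContinuousAt.continuousWithinAt (continuousAt_of_dominated
    (bound := fun t => Real.exp (-(r / 2) * Real.cosh t) * Real.cosh (2 * t)) ?_ ?_
    (integrableOn_besselK2 (half_pos hr)) ?_)
  · exact Eventually.of_forall fun s => by fun_prop
  · filter_upwards [Ioi_mem_nhds (half_lt_self hr)] with s hs
    refine ae_of_all _ fun t => ?_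
    rw [Real.norm_of_nonneg (by positivity)]
    have hs : r / 2 < s := hs
    refine mul_le_mul_of_nonneg_right (Real.exp_le_exp.mpr ?_) (by positivity)
    nlinarith [Real.cosh_pos t]
  · exact ae_of_all _ fun t => by fun_prop

/-- The function `√r e^r K₂(r)`. -/
def scaledBesselK2 (r : ℝ) : ℝ := √r * Real.exp r * besselK2 r

/-- Laplace's method: `e^r` moves the minimum of the exponent to zero, and `t = s/√r` gives the peak
at the origin a width independent of `r`. -/
lemma scaledBesselK2_eq {r : ℝ} (hr : 0 < r) :
    scaledBesselK2 r = ∫ s in Ioi (0 : ℝ),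
      Real.exp (-(r * (Real.cosh (s / √r) - 1))) * Real.cosh (2 * (s / √r)) := by
  have hs : 0 < √r := Real.sqrt_pos.mpr hr
  have h := integral_comp_mul_left_Ioi
    (fun t => Real.exp (-(r * (Real.cosh t - 1))) * Real.cosh (2 * t)) 0 (inv_pos.mpr hs)
  simp only [mul_zero, inv_inv, smul_eq_mul] at h
  simp_rw [div_eq_inv_mul]
  rw [h, scaledBesselK2, besselK2, mul_assoc, ← integral_const_mul]
  congr 2
  funext t
  rw [← mul_assoc, ← Real.exp_add]
  ring_nf

lemma scaledBesselK2_integrand_le {r : ℝ} (hr : 1 ≤ r) (s : ℝ) :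
    Real.exp (-(r * (Real.cosh (s / √r) - 1))) * Real.cosh (2 * (s / √r)) ≤
      Real.exp (-(1 * s ^ 2 / 2)) * Real.cosh (2 * s) := by
  have hr0 : 0 < r := one_pos.trans_le hr
  have hsq : √r ^ 2 = r := Real.sq_sqrt hr0.le
  have h1 : 1 ≤ √r := Real.one_le_sqrt.mpr hr
  refine mul_le_mul (Real.exp_le_exp.mpr ?_) (Real.cosh_le_cosh.mpr ?_) (by positivity)
    (by positivity)
  · have h := one_add_sq_div_two_le_cosh (s / √r)
    rw [div_pow, hsq] at h
    have h2 : r * (s ^ 2 / r / 2) = s ^ 2 / 2 := by field_simp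
    nlinarith
  · rw [abs_mul, abs_mul, abs_div, abs_of_pos (one_pos.trans_le h1)]
    exact mul_le_mul_of_nonneg_left (div_le_self (abs_nonneg _) h1) (abs_nonneg _)

lemma exists_scaledBesselK2_le : ∃ B : ℝ, 0 ≤ B ∧ ∀ r, 1 ≤ r → scaledBesselK2 r ≤ B := by
  refine ⟨∫ s in Ioi (0 : ℝ), Real.exp (-(1 * s ^ 2 / 2)) * Real.cosh (2 * s),
    integral_nonneg fun s => by positivity, fun r hr => ?_⟩
  rw [scaledBesselK2_eq (one_pos.trans_le hr)]
  exact integral_mono_of_nonneg (ae_of_all _ fun s => by positivity)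
    (integrableOn_gaussian_mul_cosh one_pos) (ae_of_all _ fun s => scaledBesselK2_integrand_le hr s)

/-- Squeeze with `1 + x²/2 ≤ cosh x ≤ e^{x²/2}`; the upper bound becomes a difference quotient of an
exponential at 0 with step `1/r`. -/
lemma tendsto_mul_cosh_sub_one (s : ℝ) :
    Tendsto (fun r : ℝ => r * (Real.cosh (s / √r) - 1)) atTop (𝓝 (s ^ 2 / 2)) := by
  have hexp : Tendsto (fun r : ℝ => r * (Real.exp (s ^ 2 / 2 * r⁻¹) - 1)) atTop (𝓝 (s ^ 2 / 2)) := by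
    have hd : HasDerivAt (fun y : ℝ => Real.exp (s ^ 2 / 2 * y)) (s ^ 2 / 2) 0 := by
      simpa using ((hasDerivAt_id (0 : ℝ)).const_mul (s ^ 2 / 2)).exp
    have h := hd.tendsto_slope.comp (tendsto_inv_atTop_nhdsGT_zero.mono_right
      (nhdsWithin_mono _ fun y (hy : 0 < y) => hy.ne'))
    refine h.congr' ?_
    filter_upwards [eventually_gt_atTop 0] with r hr
    simp [slope_def_field, div_eq_mul_inv, mul_comm]
  refine tendsto_of_tendsto_of_tendsto_of_le_of_le' tendsto_const_nhds hexp ?_ ?_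
  · filter_upwards [eventually_gt_atTop 0] with r hr
    have h := one_add_sq_div_two_le_cosh (s / √r)
    rw [div_pow, Real.sq_sqrt hr.le] at h
    have h2 : r * (s ^ 2 / r / 2) = s ^ 2 / 2 := by field_simp
    nlinarith
  · filter_upwards [eventually_gt_atTop 0] with r hr
    have h := Real.cosh_le_exp_half_sq (s / √r)
    rw [div_pow, Real.sq_sqrt hr.le] at h
    have h2 : s ^ 2 / r / 2 = s ^ 2 / 2 * r⁻¹ := by field_simp
    rw [h2] at h
    exact mul_le_mul_of_nonneg_left (by linarith) hr.le

/-- The leading asymptotics of `K₂`. -/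
lemma tendsto_scaledBesselK2 : Tendsto scaledBesselK2 atTop (𝓝 √(Real.pi / 2)) := by
  have hval : ∫ s in Ioi (0 : ℝ), Real.exp (-(s ^ 2 / 2)) * 1 = √(Real.pi / 2) := by
    have h := integral_gaussian_Ioi (1 / 2)
    simp only [mul_one]
    have h' : ∀ s : ℝ, -(s ^ 2 / 2) = -(1 / 2) * s ^ 2 := fun s => by ring
    simp_rw [h']
    rw [h, show Real.pi / (1 / 2) = Real.pi / 2 * 2 ^ 2 by ring, Real.sqrt_mul (by positivity),
      Real.sqrt_sq zero_le_two, mul_div_cancel_right₀ _ two_ne_zero]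
  rw [← hval]
  refine Tendsto.congr' (f₁ := fun r => ∫ s in Ioi (0 : ℝ),
      Real.exp (-(r * (Real.cosh (s / √r) - 1))) * Real.cosh (2 * (s / √r))) ?_ ?_
  · filter_upwards [eventually_gt_atTop 0] with r hr
    exact (scaledBesselK2_eq hr).symm
  refine tendsto_integral_filter_of_dominated_convergence
    (fun s => Real.exp (-(1 * s ^ 2 / 2)) * Real.cosh (2 * s)) ?_ ?_
    (integrableOn_gaussian_mul_cosh one_pos) ?_
  · exact Eventually.of_forall fun r => by fun_prop
  · filter_upwards [eventually_ge_atTop 1] with r hr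
    refine ae_of_all _ fun s => ?_
    rw [Real.norm_of_nonneg (by positivity)]
    exact scaledBesselK2_integrand_le hr s
  · refine ae_of_all _ fun s => ?_
    refine ((Real.continuous_exp.tendsto _).comp (tendsto_mul_cosh_sub_one s).neg).mul ?_
    have h0 : Tendsto (fun r : ℝ => 2 * (s / √r)) atTop (𝓝 (2 * 0)) :=
      (tendsto_const_nhds.div_atTop Real.tendsto_sqrt_atTop).const_mul 2
    have h := (Real.continuous_cosh.tendsto _).comp h0
    simpa [Function.comp_def] using h

end Bessel

/-! ### Second order expansion along a slice -/

section Taylor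

variable {E : Type*} [NormedAddCommGroup E] [NormedSpace ℝ E]

/-- The derivative in the first variable of a smooth function on `[0, b) × X` is smooth. -/
lemma exists_contDiffOn_slice_deriv {b : ℝ} {X : Set E} (hX : IsOpen X)
    {F : ℝ × E → ℝ} (hF : ContDiffOn ℝ ∞ F (Ico 0 b ×ˢ X)) :
    ∃ D : ℝ × E → ℝ, ContDiffOn ℝ ∞ D (Ico 0 b ×ˢ X) ∧ ∀ y ∈ Ico 0 b, ∀ x ∈ X,
      HasDerivWithinAt (fun y => F (y, x)) (D (y, x)) (Ico 0 b) y := by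
  have hu : UniqueDiffOn ℝ (Ico 0 b ×ˢ X) := (uniqueDiffOn_Ico 0 b).prod hX.uniqueDiffOn
  refine ⟨fun q => fderivWithin ℝ F (Ico 0 b ×ˢ X) q (1, 0),
    (hF.fderivWithin hu (by simp)).clm_apply contDiffOn_const, fun y hy x hx => ?_⟩
  have h := ((hF.differentiableOn (by simp)) (y, x) ⟨hy, hx⟩).hasFDerivWithinAt
  exact h.comp_hasDerivWithinAt y
    (((hasDerivAt_id y).prodMk (hasDerivAt_const y x)).hasDerivWithinAt)
    (fun t ht => Set.mk_mem_prod ht hx)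

/-- Taylor's formula with Lagrange remainder, at a critical point. -/
lemma exists_sub_eq_half_mul_sq {b : ℝ} {f f' f'' : ℝ → ℝ}
    (hf : ∀ y ∈ Ico 0 b, HasDerivWithinAt f (f' y) (Ico 0 b) y)
    (hf' : ∀ y ∈ Ico 0 b, HasDerivWithinAt f' (f'' y) (Ico 0 b) y) (h0 : f' 0 = 0)
    {y : ℝ} (hy : y ∈ Ioo 0 b) : ∃ η ∈ Ioo 0 y, f y - f 0 = f'' η / 2 * y ^ 2 := by
  have hc : ∀ {g g' : ℝ → ℝ}, (∀ y ∈ Ico 0 b, HasDerivWithinAt g (g' y) (Ico 0 b) y) →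
      ∀ z ∈ Ioo 0 b, ContinuousOn g (Icc 0 z) ∧ ∀ t ∈ Ioo 0 z, HasDerivAt g (g' t) t := by
    intro g g' hg z hz
    refine ⟨fun t ht => ?_, fun t ht => ?_⟩
    · exact (hg t ⟨ht.1, ht.2.trans_lt hz.2⟩).continuousWithinAt.mono
        fun u hu => ⟨hu.1, hu.2.trans_lt hz.2⟩
    · exact (hg t ⟨ht.1.le, ht.2.trans hz.2⟩).hasDerivAt
        (Ico_mem_nhds ht.1 (ht.2.trans hz.2))
  -- Cauchy's mean value theorem against `t²`, then the ordinary one for `f'` on `[0, ξ]`, where `f'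
  -- 0 = 0`.
  obtain ⟨ξ, hξ, h1⟩ := exists_ratio_hasDerivAt_eq_ratio_slope f f' hy.1 (hc hf y hy).1
    (hc hf y hy).2 (fun t => t ^ 2) (fun t => 2 * t) (by fun_prop)
    fun t _ => by simpa using hasDerivAt_pow 2 t
  have hξb : ξ ∈ Ioo 0 b := ⟨hξ.1, hξ.2.trans hy.2⟩
  obtain ⟨η, hη, h2⟩ := exists_hasDerivAt_eq_slope f' f'' hξ.1 (hc hf' ξ hξb).1 (hc hf' ξ hξb).2
  refine ⟨η, ⟨hη.1, hη.2.trans hξ.2⟩, ?_⟩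
  have hξ0 := hξ.1.ne'
  rw [h0, sub_zero, sub_zero, eq_div_iff hξ0] at h2
  rw [← h2] at h1
  have h3 : ξ * ((f y - f 0) - f'' η / 2 * y ^ 2) = 0 := by linarith
  rcases mul_eq_zero.mp h3 with h | h
  · exact (hξ0 h).elim
  · linarith

end Taylor

/-! ### One-particle volume on an open region -/

section Subtype

variable {E : Type*} [MeasurableSpace E] {μ : Measure E} {D : Set E}

lemma isFiniteMeasureOnCompacts_comap_subtype [TopologicalSpace E]
    [IsFiniteMeasureOnCompacts μ] (hD : MeasurableSet D) : IsFiniteMeasureOnCompacts (μ.comap (Subtype.val : D → E)) where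
  lt_top_of_isCompact K hK := by
    rw [(MeasurableEmbedding.subtype_coe hD).comap_apply]
    exact (hK.image continuous_subtype_val).measure_lt_top

lemma nullSingletonClass_comap_subtype [NullSingletonClass μ] (hD : MeasurableSet D) :
    NullSingletonClass (μ.comap (Subtype.val : D → E)) where
  measure_singleton p := by
    rw [(MeasurableEmbedding.subtype_coe hD).comap_apply, image_singleton]
    exact measure_singleton _

end Subtype

lemma GrandCanonical.idealIntensity_ne_top {X : Type*} [TopologicalSpace X] [MeasurableSpace X]
    [OpensMeasurableSpace X] (E : GrandCanonical X) [IsLocallyFiniteMeasure E.dx] {φ : X → ℝ}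
    (hφ : Continuous φ) {S : Set X} (hS : S ∈ BoundedBorel X) : E.idealIntensity φ S ≠ ⊤ := by
  have : IsLocallyFiniteMeasure (E.idealIntensity φ) :=
    IsLocallyFiniteMeasure.withDensity_ofReal (by fun_prop)
  exact ((measure_mono subset_closure).trans_lt hS.2.measure_lt_top).ne

/-! ### The Fermi surface -/

namespace KillingObserver

variable {c : ℝ} (S : KillingObserver.{u} c)

lemma continuous_spatial : Continuous spatial := by
  refine (PiLp.continuous_toLp 2 _).comp (continuous_pi fun i => ?_)
  refine Fin.cases ?_ (fun j => ?_) i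
  · simpa using continuous_const
  · exact (continuous_apply j).comp (PiLp.continuous_ofLp 2 fun _ : Fin 3 => ℝ)

lemma isOpen_fermiDomain : IsOpen S.fermiDomain :=
  S.normal_N.isOpen.preimage continuous_spatial

lemma killingNorm_pos {x : E3} (hx : x ∈ S.fermiDomain) : 0 < S.killingNorm x :=
  Real.sqrt_pos.mpr (neg_pos.mpr (S.timelike _ (S.surface_mem _ hx (by simp [spatial]))))

end KillingObserver

/-! ### The Newtonian limit of the one-particle density -/

namespace GasParameters

variable (P : GasParameters)

lemma exp_relOneBody {c : ℝ} (hc : 0 < c) (S : KillingObserver.{u} c) {x : E3} {a : ℝ} (ha : 0 < a)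
    (hx : S.killingNorm x = c * a) :
    Real.exp (-P.β * P.relOneBody S x) =
      besselK2 (c * a * P.β * P.m * c) / (c * a * P.β * P.m * c) := by
  have hβ := P.β_pos
  have hm := P.m_pos
  have hγ : 0 < c * a * P.β * P.m * c := by positivity
  have h : -P.β * P.relOneBody S x =
      Real.log (besselK2 (c * a * P.β * P.m * c) / (c * a * P.β * P.m * c)) := by
    simp only [relOneBody, hx]
    field_simp
  rw [h, Real.exp_log (div_pos (besselK2_pos hγ) hγ)]

/-- The common prefactor of the one-particle densities. -/
def prefactor : ℝ :=
  4 * Real.pi * P.m ^ 3 / (2 * Real.pi * P.hbar) ^ 3 * Real.exp (P.β * P.chem)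

lemma prefactor_pos : 0 < P.prefactor := by
  have := P.m_pos
  have := P.hbar_pos
  unfold prefactor
  positivity

/-- With `γ = β m c² a`, the rest energy `e^{β m c²}` against `e^{-γ}` leaves `exp(β m c² (1 - a))`,
while `c³` from the activity cancels against `γ^{3/2}`. What remains has a finite limit. -/
lemma relActivity_mul_besselK2 {c a : ℝ} (hc : 0 < c) (ha : 0 < a) :
    P.relActivity c * (besselK2 (c * a * P.β * P.m * c) / (c * a * P.β * P.m * c)) =
      P.prefactor * Real.exp (P.β * P.m * (c ^ 2 * (1 - a))) *
        scaledBesselK2 (c * a * P.β * P.m * c) / (P.β * P.m * a * √(P.β * P.m * a)) := by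
  have hβ := P.β_pos
  have hm := P.m_pos
  have hh := P.hbar_pos
  have hb : 0 < P.β * P.m * a := by positivity
  have hs : 0 < √(P.β * P.m * a) := Real.sqrt_pos.mpr hb
  have hsqrt : √(c * a * P.β * P.m * c) = √(P.β * P.m * a) * c := by
    rw [show c * a * P.β * P.m * c = P.β * P.m * a * c ^ 2 by ring, Real.sqrt_mul hb.le,
      Real.sqrt_sq hc.le]
  have hexp : Real.exp (P.β * (P.m * c ^ 2 + P.chem)) = Real.exp (P.β * P.chem) *
      Real.exp (P.β * P.m * (c ^ 2 * (1 - a))) * Real.exp (c * a * P.β * P.m * c) := by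
    rw [← Real.exp_add, ← Real.exp_add]
    ring_nf
  rw [relActivity, prefactor, scaledBesselK2, hsqrt, hexp]
  field_simp

lemma prefactor_mul_sqrt :
    P.prefactor * √(Real.pi / 2) / (P.β * P.m * √(P.β * P.m)) = P.newtonActivity := by
  have hβ := P.β_pos
  have hm := P.m_pos
  have hh := P.hbar_pos
  have hπ := Real.pi_pos
  have hq : 0 < P.m / (2 * Real.pi * P.hbar ^ 2 * P.β) := by positivity
  rw [newtonActivity, prefactor, show (3 / 2 : ℝ) = 1 + 1 / 2 by norm_num, Real.rpow_add hq,
    Real.rpow_one, ← Real.sqrt_eq_rpow]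
  have h : √(P.m / (2 * Real.pi * P.hbar ^ 2 * P.β)) =
      P.m * √(Real.pi / 2) / (Real.pi * P.hbar * √(P.β * P.m)) := by
    rw [Real.sqrt_eq_iff_mul_self_eq hq.le (by positivity)]
    rw [div_mul_div_comm, mul_mul_mul_comm, Real.mul_self_sqrt (by positivity),
      mul_mul_mul_comm (Real.pi * P.hbar), Real.mul_self_sqrt (by positivity)]
    field_simp
  rw [h]
  field_simp
  ring

/-- The one-particle density of the relativistic gas converges to that of the Newtonian gas. -/
lemma tendsto_relActivity_mul_besselK2 {ι : Type*} {l : Filter ι} {c a : ι → ℝ} {L : ℝ}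
    (hc : Tendsto c l atTop) (hL : Tendsto (fun i => c i ^ 2 * (1 - a i)) l (𝓝 L)) :
    Tendsto (fun i => P.relActivity (c i) *
        (besselK2 (c i * a i * P.β * P.m * c i) / (c i * a i * P.β * P.m * c i))) l
      (𝓝 (P.newtonActivity * Real.exp (P.β * P.m * L))) := by
  have hβ := P.β_pos
  have hm := P.m_pos
  have hc2 : Tendsto (fun i => c i ^ 2) l atTop := (tendsto_pow_atTop two_ne_zero).comp hc
  -- `1 - a` is a convergent quantity divided by `c² → ∞`.
  have ha : Tendsto a l (𝓝 1) := by
    have h := (hL.div_atTop hc2).const_sub 1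
    rw [sub_zero] at h
    refine h.congr' ?_
    filter_upwards [hc.eventually_gt_atTop 0] with i hi
    field_simp
    ring
  have hγ : Tendsto (fun i => c i * a i * P.β * P.m * c i) l atTop := by
    have h := (ha.mul_const (P.β * P.m)).pos_mul_atTop (by positivity) hc2
    exact h.congr fun i => by ring
  have hpos : P.β * P.m * 1 * √(P.β * P.m * 1) ≠ 0 := by positivity
  have hba := ha.const_mul (P.β * P.m)
  have h := (((Real.continuous_exp.tendsto _).comp (hL.const_mul (P.β * P.m))).const_mul
    P.prefactor).mul (tendsto_scaledBesselK2.comp hγ) |>.div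
      (hba.mul ((Real.continuous_sqrt.tendsto _).comp hba)) hpos
  have hval : P.prefactor * Real.exp (P.β * P.m * L) * √(Real.pi / 2) /
      (P.β * P.m * 1 * √(P.β * P.m * 1)) = P.newtonActivity * Real.exp (P.β * P.m * L) := by
    rw [← P.prefactor_mul_sqrt, mul_one]
    ring
  rw [hval] at h
  refine h.congr' ?_
  filter_upwards [hc.eventually_gt_atTop 0, ha.eventually (lt_mem_nhds one_pos)] with i hi hai
  exact (P.relActivity_mul_besselK2 hi hai).symm

/-- The dominating constant for the limit, uniform in the position. The conditions on `a` and `c`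
give `γ ≥ 1`, where the scaled Bessel function is bounded, and keep the denominator away from 0.
Only an upper bound on `c² (1 - a)` matters. -/
lemma exists_relActivity_mul_besselK2_le (M : ℝ) : ∃ C : ℝ, ∀ c a : ℝ, 0 < c → 1 / 2 ≤ a →
    2 ≤ P.β * P.m * c ^ 2 → c ^ 2 * (1 - a) ≤ M →
    P.relActivity c * (besselK2 (c * a * P.β * P.m * c) / (c * a * P.β * P.m * c)) ≤ C := by
  obtain ⟨B, hB0, hB⟩ := exists_scaledBesselK2_le
  have hβ := P.β_pos
  have hm := P.m_pos
  have hA := P.prefactor_pos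
  refine ⟨P.prefactor * Real.exp (P.β * P.m * M) * B /
    (P.β * P.m * (1 / 2) * √(P.β * P.m * (1 / 2))), fun c a hc ha hc2 hM => ?_⟩
  have ha0 : 0 < a := by linarith
  rw [P.relActivity_mul_besselK2 hc ha0]
  have hγ : 1 ≤ c * a * P.β * P.m * c := by nlinarith
  have hb : P.β * P.m * (1 / 2) ≤ P.β * P.m * a := by gcongr
  have hle := hB _ hγ
  have hnn : 0 ≤ scaledBesselK2 (c * a * P.β * P.m * c) := by
    have := besselK2_pos (one_pos.trans_le hγ)
    unfold scaledBesselK2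
    positivity
  gcongr

end GasParameters

end

theorem mainTheorem2 (P : GasParameters) (c₀ : ℝ) (hc₀ : 0 < c₀)
    (S : (c : Set.Ioi c₀) → KillingObserver.{u} (c : ℝ))
    (X : Set E3) (hX : ∀ c, (S c).fermiDomain = X)
    (hunb : ¬ Bornology.IsBounded X)
    (α : ℝ → E3 → ℝ)
    (hα_smooth : ContDiffOn ℝ ∞ (fun q : ℝ × E3 => α q.1 q.2) (Set.Ico 0 (1 / c₀) ×ˢ X))
    (hα : ∀ c : Set.Ioi c₀, ∀ x ∈ X, α (1 / (c : ℝ)) x = (S c).alpha x)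
    (hα_zero : ∀ x ∈ X, α 0 x = 1)
    (hα_deriv : ∀ x ∈ X, derivWithin (fun y => α y x) (Set.Ico 0 (1 / c₀)) 0 = 0) :
    (∀ c : Set.Ioi c₀, ∃! μ : Measure (Configuration X),
      (P.relativisticGas (S c) X).IsGibbsState μ) ∧
    (∃! μ : Measure (Configuration X),
      (P.newtonianGas X fun x =>
        P.m / 2 * iteratedDerivWithin 2 (fun y => α y x) (Set.Ico 0 (1 / c₀)) 0).IsGibbsState μ) ∧
    (∀ (μ : Set.Ioi c₀ → Measure (Configuration X)) (μNewt : Measure (Configuration X)),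
      (∀ c, (P.relativisticGas (S c) X).IsGibbsState (μ c)) →
      (P.newtonianGas X fun x =>
        P.m / 2 * iteratedDerivWithin 2 (fun y => α y x) (Set.Ico 0 (1 / c₀)) 0).IsGibbsState
          μNewt →
      ∀ A : Set (Configuration X), Configuration.IsCylinder A →
        Tendsto (fun c => μ c A) atTop (𝓝 (μNewt A))) := by
  have hβ := P.β_pos
  have hm := P.m_pos
  have hh := P.hbar_pos
  have hXo : IsOpen X := hX ⟨c₀ + 1, lt_add_one c₀⟩ ▸ (S _).isOpen_fermiDomain
  have hb : 0 < 1 / c₀ := one_div_pos.mpr hc₀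
  have hcpos : ∀ c : Set.Ioi c₀, 0 < (c : ℝ) := fun c => hc₀.trans c.2
  have hinv : ∀ c : Set.Ioi c₀, 1 / (c : ℝ) ∈ Ioo 0 (1 / c₀) := fun c =>
    ⟨one_div_pos.mpr (hcpos c), one_div_lt_one_div_of_lt hc₀ c.2⟩
  -- expansion of `α`
  obtain ⟨α₁, hα₁s, hα₁⟩ := exists_contDiffOn_slice_deriv hXo hα_smooth
  obtain ⟨α₂, hα₂s, hα₂⟩ := exists_contDiffOn_slice_deriv hXo hα₁s
  have hu : UniqueDiffOn ℝ (Ico 0 (1 / c₀)) := uniqueDiffOn_Ico _ _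
  have h0 : (0 : ℝ) ∈ Ico 0 (1 / c₀) := ⟨le_rfl, hb⟩
  have hα₁0 : ∀ x ∈ X, α₁ (0, x) = 0 := fun x hx =>
    ((hα₁ 0 h0 x hx).derivWithin (hu 0 h0)).symm.trans (hα_deriv x hx)
  have hα₂0 : ∀ x ∈ X, iteratedDerivWithin 2 (fun y => α y x) (Ico 0 (1 / c₀)) 0 = α₂ (0, x) := by
    intro x hx
    rw [iteratedDerivWithin_succ, ← (hα₂ 0 h0 x hx).derivWithin (hu 0 h0)]
    refine derivWithin_congr (fun y hy => ?_) ?_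
    all_goals rw [iteratedDerivWithin_one]
    · exact (hα₁ y hy x hx).derivWithin (hu y hy)
    · exact (hα₁ 0 h0 x hx).derivWithin (hu 0 h0)
  -- Taylor's formula at `y = 1/c`, multiplied by `c²`: the constant and linear terms drop out, and
  -- an exact remainder is left.
  have hexp : ∀ c : Set.Ioi c₀, ∀ x ∈ X, ∃ η ∈ Ioo 0 (1 / (c : ℝ)),
      (c : ℝ) ^ 2 * (1 - α (1 / c) x) = -(α₂ (η, x) / 2) := by
    intro c x hx
    obtain ⟨η, hη, h⟩ := exists_sub_eq_half_mul_sq (fun y hy => hα₁ y hy x hx)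
      (fun y hy => hα₂ y hy x hx) (hα₁0 x hx) (hinv c)
    refine ⟨η, hη, ?_⟩
    have hc := hcpos c
    simp only [hα_zero x hx] at h
    rw [← neg_sub, h]
    field_simp
  -- one-body potentials
  have hαpos : ∀ c : Set.Ioi c₀, ∀ x ∈ X, 0 < α (1 / c) x := fun c x hx => by
    rw [hα c x hx]
    exact div_pos ((S c).killingNorm_pos (hX c ▸ hx)) (hcpos c)
  have hnorm : ∀ c : Set.Ioi c₀, ∀ x ∈ X, (S c).killingNorm x = c * α (1 / c) x := fun c x hx => by
    rw [hα c x hx, KillingObserver.alpha, mul_div_cancel₀ _ (hcpos c).ne']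
  -- Continuity of the Killing norm on `X` is read off from the smoothness of `α`, since `‖K‖ = c
  -- α(1/c, ·)` there.
  have hφ : ∀ c : Set.Ioi c₀, Continuous fun x : X => P.relOneBody (S c) x := by
    intro c
    have hαc : Continuous fun x : X => α (1 / c) x :=
      hα_smooth.continuousOn.comp_continuous (f := fun x : X => ((1 / c : ℝ), (x : E3)))
        (by fun_prop) fun x => ⟨⟨(hinv c).1.le, (hinv c).2⟩, x.2⟩
    have hγ : ∀ x : X, 0 < (S c).killingNorm x * P.β * P.m * c := fun x => by
      have := (S c).killingNorm_pos (x := x) (by rw [hX]; exact x.2)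
      have := hcpos c
      positivity
    have hγc : Continuous fun x : X => (S c).killingNorm x * P.β * P.m * c := by
      simp only [fun x : X => hnorm c x x.2]
      exact (((hαc.const_mul _).mul_const _).mul_const _).mul_const _
    refine continuous_const.mul (Continuous.log ((continuousOn_besselK2.comp_continuous hγc hγ).div
      hγc fun x => (hγ x).ne') fun x => (div_pos (besselK2_pos (hγ x)) (hγ x)).ne')
  let W : E3 → ℝ := fun x =>
    P.m / 2 * iteratedDerivWithin 2 (fun y => α y x) (Set.Ico 0 (1 / c₀)) 0
  have hW : Continuous fun x : X => W x := by
    have h : (fun x : X => W x) = fun x : X => P.m / 2 * α₂ (0, x) := by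
      funext x
      simp only [W, hα₂0 x x.2]
    rw [h]
    exact continuous_const.mul (hα₂s.continuousOn.comp_continuous
      (f := fun x : X => ((0 : ℝ), (x : E3))) (by fun_prop) fun x => ⟨h0, x.2⟩)
  -- the two gases
  let ν : Measure X := (volume : Measure E3).comap Subtype.val
  have hν : IsFiniteMeasureOnCompacts ν :=
    isFiniteMeasureOnCompacts_comap_subtype hXo.measurableSet
  have hν' : NullSingletonClass ν := nullSingletonClass_comap_subtype hXo.measurableSet
  have : LocallyCompactSpace X := hXo.locallyCompactSpace
  have hνl : IsLocallyFiniteMeasure ν := inferInstance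
  let R : Set.Ioi c₀ → GrandCanonical X := fun c => P.relativisticGas (S c) X
  let N : GrandCanonical X := P.newtonianGas X W
  have i1 : ∀ c, IsFiniteMeasureOnCompacts (R c).dx := fun _ => hν
  have i2 : ∀ c, NullSingletonClass (R c).dx := fun _ => hν'
  have i3 : ∀ c, IsLocallyFiniteMeasure (R c).dx := fun _ => hνl
  have j1 : IsFiniteMeasureOnCompacts N.dx := hν
  have j2 : NullSingletonClass N.dx := hν'
  have j3 : IsLocallyFiniteMeasure N.dx := hνl
  have hzR : ∀ c, 0 ≤ (R c).activity := fun c => by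
    have := hcpos c
    change 0 ≤ P.relActivity c
    unfold GasParameters.relActivity
    positivity
  have hzN : 0 ≤ N.activity := by
    change 0 ≤ P.newtonActivity
    unfold GasParameters.newtonActivity
    positivity
  refine ⟨fun c => (R c).existsUnique_isGibbsState rfl (hφ c).measurable (hzR c)
      fun T hT => (R c).idealIntensity_ne_top (hφ c) hT,
    N.existsUnique_isGibbsState rfl hW.measurable hzN fun T hT => N.idealIntensity_ne_top hW hT,
    fun μ μN hμ hμN A ⟨T, hT, hA⟩ => ?_⟩
  have hlaw : ∀ c, μ c A = Configuration.poissonLaw (((R c).idealIntensity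
      fun x : X => P.relOneBody (S c) x).restrict T) A := fun c =>
    GrandCanonical.IsGibbsState.apply_of_localSigma (E := R c) rfl (hφ c).measurable (hzR c)
      (fun T hT => (R c).idealIntensity_ne_top (hφ c) hT) (hμ c) hT hA
  have hlawN : μN A = Configuration.poissonLaw ((N.idealIntensity fun x : X => W x).restrict T) A :=
    GrandCanonical.IsGibbsState.apply_of_localSigma (E := N) rfl hW.measurable hzN
      (fun T hT => N.idealIntensity_ne_top hW hT) hμN hT hA
  simp_rw [hlaw, hlawN, GrandCanonical.idealIntensity, restrict_withDensity hT.1]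
  have hcount : (atTop : Filter (Set.Ioi c₀)).IsCountablyGenerated := by
    rw [atTop_Ioi_eq]
    infer_instance
  have hctop : Tendsto (fun c : Set.Ioi c₀ => (c : ℝ)) atTop atTop := (map_val_Ioi_atTop c₀).le
  have hfinT : IsFiniteMeasure (ν.restrict T) :=
    ⟨by simpa using (measure_mono subset_closure).trans_lt hT.2.measure_lt_top⟩
  have hdens : ∀ c : Set.Ioi c₀, ∀ x : X,
      P.relActivity c * Real.exp (-P.β * P.relOneBody (S c) x) =
        P.relActivity c * (besselK2 (c * α (1 / c) x * P.β * P.m * c) /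
          (c * α (1 / c) x * P.β * P.m * c)) := fun c x => by
    rw [P.exp_relOneBody (hcpos c) (S c) (hαpos c x x.2) (hnorm c x x.2)]
  have hlim : ∀ x : X, Tendsto
      (fun c : Set.Ioi c₀ => P.relActivity c * Real.exp (-P.β * P.relOneBody (S c) x)) atTop
      (𝓝 (P.newtonActivity * Real.exp (-P.β * W x))) := by
    intro x
    choose η hη hηe using fun c : Set.Ioi c₀ => hexp c x x.2
    have hη0 : Tendsto η atTop (𝓝[Ico 0 (1 / c₀)] 0) := by
      refine tendsto_nhdsWithin_iff.mpr ⟨?_, Eventually.of_forall fun c =>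
        ⟨(hη c).1.le, (hη c).2.trans (hinv c).2⟩⟩
      exact tendsto_of_tendsto_of_tendsto_of_le_of_le tendsto_const_nhds
        (tendsto_const_nhds.div_atTop hctop) (fun c => (hη c).1.le) fun c => (hη c).2.le
    have hc2 : ContinuousWithinAt (fun y => α₂ (y, (x : E3))) (Ico 0 (1 / c₀)) 0 :=
      (hα₂s.continuousOn (0, (x : E3)) ⟨h0, x.2⟩).comp (f := fun y : ℝ => (y, (x : E3)))
        (by fun_prop) fun y hy => ⟨hy, x.2⟩
    -- The intermediate points tend to 0 within the half-open interval, and `α₂` is continuous there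
    -- up to the endpoint.
    have hL : Tendsto (fun c : Set.Ioi c₀ => (c : ℝ) ^ 2 * (1 - α (1 / c) x)) atTop
        (𝓝 (-(α₂ (0, (x : E3)) / 2))) := by
      simp_rw [hηe]
      exact ((hc2.tendsto.comp hη0).div_const 2).neg
    have h := P.tendsto_relActivity_mul_besselK2 hctop hL
    simp_rw [hdens]
    convert h using 3
    simp only [W, hα₂0 x x.2]
    ring_nf
  have hbd : ∃ C : ℝ, ∀ᶠ c : Set.Ioi c₀ in atTop, ∀ x ∈ T,
      P.relActivity c * Real.exp (-P.β * P.relOneBody (S c) x) ≤ C := by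
    -- For `c ≥ 2 c₀` every intermediate point lies in `[0, 1/(2c₀)]`, a compact part of `[0,
    -- 1/c₀)`, so `α₂` is bounded by some `M` uniformly over `T`. Then `c² ≥ M` forces `α ≥ 1/2`.
    have hK : IsCompact (Icc (0 : ℝ) (1 / (2 * c₀)) ×ˢ (Subtype.val '' closure T)) :=
      isCompact_Icc.prod (hT.2.image continuous_subtype_val)
    have h2 : 1 / (2 * c₀) < 1 / c₀ := one_div_lt_one_div_of_lt hc₀ (by linarith)
    obtain ⟨M, hM⟩ := hK.exists_bound_of_continuousOn (hα₂s.continuousOn.mono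
      (prod_mono (fun y hy => ⟨hy.1, hy.2.trans_lt h2⟩) (by rintro _ ⟨x, -, rfl⟩; exact x.2)))
    obtain ⟨C, hC⟩ := P.exists_relActivity_mul_besselK2_le (M / 2)
    have hc2 : Tendsto (fun c : Set.Ioi c₀ => (c : ℝ) ^ 2) atTop atTop :=
      (tendsto_pow_atTop two_ne_zero).comp hctop
    refine ⟨C, ?_⟩
    filter_upwards [hctop.eventually_ge_atTop (2 * c₀), hc2.eventually_ge_atTop M,
      (hc2.const_mul_atTop (mul_pos hβ hm)).eventually_ge_atTop 2] with c h1 h3 h4 x hx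
    obtain ⟨η, hη, he⟩ := hexp c x x.2
    have hηM := hM (η, x) ⟨⟨hη.1.le, hη.2.le.trans
      (one_div_le_one_div_of_le (by positivity) h1)⟩, ⟨x, subset_closure hx, rfl⟩⟩
    rw [Real.norm_eq_abs] at hηM
    have hle : (c : ℝ) ^ 2 * (1 - α (1 / c) x) ≤ M / 2 := by
      rw [he]
      linarith [neg_abs_le (α₂ (η, x))]
    rw [hdens]
    refine hC c _ (hcpos c) ?_ h4 hle
    have hcc : 0 < (c : ℝ) ^ 2 := pow_pos (hcpos c) 2
    nlinarith
  obtain ⟨C, hC⟩ := hbd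
  -- The uniform bound passes to the pointwise limit.
  have hCN : ∀ x ∈ T, P.newtonActivity * Real.exp (-P.β * W x) ≤ C := fun x hx =>
    le_of_tendsto (hlim x) (hC.mono fun c h => h x hx)
  refine Configuration.tendsto_poissonLaw_withDensity (ν.restrict T) (C := ENNReal.ofReal C)
    (fun c => ?_) ?_ ENNReal.ofReal_ne_top ?_ ?_ ?_ (Configuration.localSigma_le T A hA)
  · exact (((Real.measurable_exp.comp ((hφ c).measurable.const_mul _)).const_mul _)).ennreal_ofReal
  · exact (((Real.measurable_exp.comp (hW.measurable.const_mul _)).const_mul _)).ennreal_ofReal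
  · filter_upwards [hC] with c hc
    filter_upwards [ae_restrict_mem hT.1] with x hx
    exact ENNReal.ofReal_le_ofReal (hc x hx)
  · filter_upwards [ae_restrict_mem hT.1] with x hx
    exact ENNReal.ofReal_le_ofReal (hCN x hx)
  · exact ae_of_all _ fun x => ENNReal.tendsto_ofReal (hlim x)
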